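/- Let $n\ge 1$. A Young function is a convex, left-continuous function $\Phi:[0,\infty]\to[0,\infty]$ with $\lim_{r\to+0}\Phi(r)=\Phi(0)=0$ and $\lim_{r\to\infty}\Phi(r)=\Phi(\infty)=\infty$; put $\Phi^{-1}(s)=\inf\{r\ge 0:\Phi(r)>s\}$ ($\inf\emptyset=\infty$), and write $\Phi\in\nabla_2$ if for some $C>1$ one has $\Phi(r)\le\frac1{2C}\Phi(Cr)$ for all $r\ge0$. For measurable $f$ on $\mathbb R^n$ and $\Omega\subset\mathbb R^n$ let $$\|f\|_{L^\Phi}=\inf\Big\{\lambda>0:\int_{\mathbb R^n}\Phi\Big(\frac{|f(x)|}{\lambda}\Big)dx\le1\Big\},\qquad \|f\|_{\mathrm WL^\Phi}=\sup_{\lambda>0}\big\|\lambda\,\chi_{\{|f|>\lambda\}}\big\|_{L^\Phi},$$ $\|f\|_{L^\Phi(\Omega)}=\|f\chi_\Omega\|_{L^\Phi}$ and $\|f\|_{\mathrm WL^\Phi(\Omega)}=\|f\chi_\Omega\|_{\mathrm WL^\Phi}$. Let $L^\Phi(\mathbb R^n)$ be the set of $f\in L^1_{\rm loc}(\mathbb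 R^n)$ with $\int\Phi(k|f|)\,dx<\infty$ for some $k>0$, let $\mathrm WL^\Phi(\mathbb R^n)$ be the set of measurable $f$ with $\|f\|_{\mathrm WL^\Phi}<\infty$, and let $L^\Phi_{\rm loc}$, $\mathrm WL^\Phi_{\rm loc}$ be the sets of measurable $f$ such that $f\chi_B$ lies in $L^\Phi(\mathbb R^n)$, respectively $\mathrm WL^\Phi(\mathbb R^n)$, for every ball $B$. For $\varphi:(0,\infty)\to(0,\infty)$ the generalized Orlicz--Morrey space (of the third kind) $\mathcal M^{\Phi,\varphi}(\mathbb R^n)$ consists of all $f\in L^\Phi_{\rm loc}$ with $$\|f\|_{\mathcal M^{\Phi,\varphi}}=\sup_{x\in\mathbb R^n,\,r>0}\varphi(r)^{-1}\Phi^{-1}(r^{-n})\|f\|_{L^\Phi(B(x,r))}<\infty,$$ and its weak version $\mathrm W\mathcal M^{\Phi,\varphi}(\mathbb R^n)$ consists of all $f\in \mathrm WL^\Phi_{\rm loc}$ for which the quantity $\|f\|_{\mathrm W\mathcal M^{\Phi,\varphi}}$, obtained by replacing $L^\Phi(B(x,r))$ by $\mathrm WL^\Phi(B(x,r))$, is finite.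 A function $g:(0,\infty)\to(0,\infty)$ is almost increasing (almost decreasing) if there is $C>0$ with $g(r)\le Cg(s)$ (respectively $g(s)\le Cg(r)$) for all $0<r\le s$. Let $\mathcal G_\Phi$ be the set of all $\varphi:(0,\infty)\to(0,\infty)$ such that $t\mapsto\varphi(t)/\Phi^{-1}(t^{-n})$ is almost increasing and $t\mapsto\varphi(t)/(\Phi^{-1}(t^{-n})t^n)$ is almost decreasing. For $\rho:(0,\infty)\to(0,\infty)$ let $$M_\rho f(x)=\sup_{r>0}\frac{\rho(r)}{|B(x,r)|}\int_{B(x,r)}|f(y)|\,dy .$$ **Theorem.** Let $\Phi$ be a Young function and let $\varphi\in\mathcal G_\Phi$ be almost decreasing. Let $\rho:(0,\infty)\to(0,\infty)$ be increasing with $r\mapsto r^{-n}\rho(r)$ decreasing (both in the non-strict sense). Let $\beta\in(0,1)$, $\eta(t)=\varphi(t)^\beta$ and $\Psi(t)=\Phi(t^{1/\beta})$. 1. There is a constant $C>0$ with $$\rho(t)\le C\,\varphi(t)^{\beta-1}\qquad\text{for all }t>0 \tag{$*$}$$ if and only if $M_\rho$ is bounded from $\mathcal M^{\Phi,\varphi}(\mathbb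 R^n)$ to $\mathrm W\mathcal M^{\Psi,\eta}(\mathbb R^n)$, that is, there is a finite constant $C'$ such that for every $f\in\mathcal M^{\Phi,\varphi}(\mathbb R^n)$ one has $M_\rho f\in \mathrm W\mathcal M^{\Psi,\eta}(\mathbb R^n)$ and $\|M_\rho f\|_{\mathrm W\mathcal M^{\Psi,\eta}}\le C'\|f\|_{\mathcal M^{\Phi,\varphi}}$. 2. If $\Phi\in\nabla_2$, then $(*)$ holds for some $C>0$ if and only if $M_\rho$ is bounded, in the same sense, from $\mathcal M^{\Phi,\varphi}(\mathbb R^n)$ to $\mathcal M^{\Psi,\eta}(\mathbb R^n)$. -/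

import Mathlib

open MeasureTheory Set Filter Topology
open scoped ENNReal NNReal

namespace OrliczMorrey

/-- A Young function `Φ : [0,∞] → [0,∞]`. -/
structure IsYoung (Φ : ℝ≥0∞ → ℝ≥0∞) : Prop where
  convex : ConvexOn ℝ≥0 univ Φ
  left_continuous : ∀ r, ContinuousWithinAt Φ (Iic r) r
  map_zero : Φ 0 = 0
  tendsto_zero : Tendsto Φ (𝓝[>] 0) (𝓝 0)
  map_top : Φ ∞ = ∞
  tendsto_top : Tendsto Φ (𝓝[<] ∞) (𝓝 ∞)

/-- The generalized inverse `Φ⁻¹(s) = inf {r ≥ 0 : Φ(r) > s}`, with `inf ∅ = ∞`. -/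
noncomputable def youngInv (Φ : ℝ≥0∞ → ℝ≥0∞) (s : ℝ≥0∞) : ℝ≥0∞ :=
  sInf {r | s < Φ r}

/-- The `∇₂`-condition: `Φ(r) ≤ Φ(C r) / (2 C)` for all `r ≥ 0`, for some `C > 1`. -/
def Nabla2 (Φ : ℝ≥0∞ → ℝ≥0∞) : Prop :=
  ∃ C : ℝ≥0, 1 < C ∧ ∀ r : ℝ≥0∞, Φ r ≤ Φ (C * r) / (2 * C)

/-- `g` is almost increasing on `(0,∞)`. -/
def AlmostIncreasing (g : ℝ → ℝ≥0∞) : Prop :=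
  ∃ C : ℝ≥0, 0 < C ∧ ∀ r s : ℝ, 0 < r → r ≤ s → g r ≤ C * g s

/-- `g` is almost decreasing on `(0,∞)`. -/
def AlmostDecreasing (g : ℝ → ℝ≥0∞) : Prop :=
  ∃ C : ℝ≥0, 0 < C ∧ ∀ r s : ℝ, 0 < r → r ≤ s → g s ≤ C * g r

/-- `Φ⁻¹(r⁻ⁿ)`; for a Young function and `r > 0` this is a positive finite number. -/
noncomputable def invAt (n : ℕ) (Φ : ℝ≥0∞ → ℝ≥0∞) (r : ℝ) : ℝ≥0∞ :=
  youngInv Φ (ENNReal.ofReal ((r ^ n)⁻¹))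

/-- The class `𝒢_Φ` of functions `φ : (0,∞) → (0,∞)` (values of `φ` off `(0,∞)` are irrelevant). -/
structure ClassG (n : ℕ) (Φ : ℝ≥0∞ → ℝ≥0∞) (φ : ℝ → ℝ) : Prop where
  pos : ∀ t, 0 < t → 0 < φ t
  almostIncreasing : AlmostIncreasing fun t => ENNReal.ofReal (φ t) / invAt n Φ t
  almostDecreasing : AlmostDecreasing fun t =>
    ENNReal.ofReal (φ t) / (invAt n Φ t * ENNReal.ofReal (t ^ n))

section Spaces

/-! The function spaces. The codomain `F` is used for the real or complex numbers and, since a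
maximal function may take the value `∞`, also for `[0,∞]`; `‖f x‖ₑ` is `|f(x)|`. -/

variable {n : ℕ} {F : Type*} [TopologicalSpace F] [ESeminormedAddMonoid F]

/-- The Luxemburg–Nakano norm `inf {l > 0 : ∫ Φ(|f| / l) ≤ 1}`, with `inf ∅ = ∞`. -/
noncomputable def orliczNorm (Φ : ℝ≥0∞ → ℝ≥0∞) (f : EuclideanSpace ℝ (Fin n) → F) : ℝ≥0∞ :=
  sInf {l | 0 < l ∧ l < ∞ ∧ ∫⁻ x, Φ (‖f x‖ₑ / l) ≤ 1}

/-- The weak Orlicz quasi-norm `sup_{l > 0} ‖l χ_{|f| > l}‖_{L^Φ}`. -/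
noncomputable def weakOrliczNorm (Φ : ℝ≥0∞ → ℝ≥0∞) (f : EuclideanSpace ℝ (Fin n) → F) : ℝ≥0∞ :=
  ⨆ l : ℝ≥0, ⨆ _ : 0 < l,
    orliczNorm Φ ({x | (l : ℝ≥0∞) < ‖f x‖ₑ}.indicator fun _ => (l : ℝ≥0∞))

/-- Membership in the Orlicz space `L^Φ(ℝⁿ)`. -/
def MemOrlicz (Φ : ℝ≥0∞ → ℝ≥0∞) (f : EuclideanSpace ℝ (Fin n) → F) : Prop :=
  LocallyIntegrable f volume ∧ ∃ k : ℝ≥0, 0 < k ∧ ∫⁻ x, Φ (k * ‖f x‖ₑ) < ∞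

/-- Membership in the weak Orlicz space `WL^Φ(ℝⁿ)`. -/
def MemWeakOrlicz (Φ : ℝ≥0∞ → ℝ≥0∞) (f : EuclideanSpace ℝ (Fin n) → F) : Prop :=
  AEStronglyMeasurable f volume ∧ weakOrliczNorm Φ f < ∞

/-- The norm of the generalized Orlicz–Morrey space `𝓜^{Φ,φ}(ℝⁿ)` of the third kind. -/
noncomputable def morreyNorm (Φ : ℝ≥0∞ → ℝ≥0∞) (φ : ℝ → ℝ)
    (f : EuclideanSpace ℝ (Fin n) → F) : ℝ≥0∞ :=
  ⨆ x : EuclideanSpace ℝ (Fin n), ⨆ r : ℝ, ⨆ _ : 0 < r,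
    (ENNReal.ofReal (φ r))⁻¹ * invAt n Φ r * orliczNorm Φ ((Metric.ball x r).indicator f)

/-- The quasi-norm of the weak generalized Orlicz–Morrey space `W𝓜^{Φ,φ}(ℝⁿ)`. -/
noncomputable def weakMorreyNorm (Φ : ℝ≥0∞ → ℝ≥0∞) (φ : ℝ → ℝ)
    (f : EuclideanSpace ℝ (Fin n) → F) : ℝ≥0∞ :=
  ⨆ x : EuclideanSpace ℝ (Fin n), ⨆ r : ℝ, ⨆ _ : 0 < r,
    (ENNReal.ofReal (φ r))⁻¹ * invAt n Φ r * weakOrliczNorm Φ ((Metric.ball x r).indicator f)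

/-- Membership in `𝓜^{Φ,φ}(ℝⁿ)`: `f ∈ L^Φ_loc(ℝⁿ)` with finite norm. -/
structure MemMorrey (Φ : ℝ≥0∞ → ℝ≥0∞) (φ : ℝ → ℝ)
    (f : EuclideanSpace ℝ (Fin n) → F) : Prop where
  measurable : AEStronglyMeasurable f volume
  local_mem : ∀ x r, 0 < r → MemOrlicz Φ ((Metric.ball x r).indicator f)
  norm_lt_top : morreyNorm Φ φ f < ∞

/-- Membership in `W𝓜^{Φ,φ}(ℝⁿ)`: `f ∈ WL^Φ_loc(ℝⁿ)` with finite quasi-norm. -/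
structure MemWeakMorrey (Φ : ℝ≥0∞ → ℝ≥0∞) (φ : ℝ → ℝ)
    (f : EuclideanSpace ℝ (Fin n) → F) : Prop where
  measurable : AEStronglyMeasurable f volume
  local_mem : ∀ x r, 0 < r → MemWeakOrlicz Φ ((Metric.ball x r).indicator f)
  norm_lt_top : weakMorreyNorm Φ φ f < ∞

/-- The generalized fractional maximal function
`M_ρ f(x) = sup_{r > 0} ρ(r) / |B(x,r)| * ∫_{B(x,r)} |f|`. -/
noncomputable def fracMax (ρ : ℝ → ℝ) (f : EuclideanSpace ℝ (Fin n) → F)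
    (x : EuclideanSpace ℝ (Fin n)) : ℝ≥0∞ :=
  ⨆ r : ℝ, ⨆ _ : 0 < r,
    ENNReal.ofReal (ρ r) / volume (Metric.ball x r) * ∫⁻ y in Metric.ball x r, ‖f y‖ₑ

end Spaces

/-- `M_ρ` is bounded from `𝓜^{Φ,φ}(ℝⁿ)` (of `𝕜`-valued functions) to `𝓜^{Ψ,η}(ℝⁿ)`. -/
def FracMaxBounded (n : ℕ) (𝕜 : Type*) [RCLike 𝕜] (ρ : ℝ → ℝ)
    (Φ : ℝ≥0∞ → ℝ≥0∞) (φ : ℝ → ℝ) (Ψ : ℝ≥0∞ → ℝ≥0∞) (η : ℝ → ℝ) : Prop :=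
  ∃ C : ℝ≥0, ∀ f : EuclideanSpace ℝ (Fin n) → 𝕜, MemMorrey Φ φ f →
    MemMorrey Ψ η (fracMax ρ f) ∧ morreyNorm Ψ η (fracMax ρ f) ≤ C * morreyNorm Φ φ f

/-- `M_ρ` is bounded from `𝓜^{Φ,φ}(ℝⁿ)` (of `𝕜`-valued functions) to `W𝓜^{Ψ,η}(ℝⁿ)`. -/
def FracMaxWeakBounded (n : ℕ) (𝕜 : Type*) [RCLike 𝕜] (ρ : ℝ → ℝ)
    (Φ : ℝ≥0∞ → ℝ≥0∞) (φ : ℝ → ℝ) (Ψ : ℝ≥0∞ → ℝ≥0∞) (η : ℝ → ℝ) : Prop :=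
  ∃ C : ℝ≥0, ∀ f : EuclideanSpace ℝ (Fin n) → 𝕜, MemMorrey Φ φ f →
    MemWeakMorrey Ψ η (fracMax ρ f) ∧ weakMorreyNorm Ψ η (fracMax ρ f) ≤ C * morreyNorm Φ φ f

end OrliczMorrey

/-! Sufficiency rests on a Hedberg-type interpolation. If `f` has norm at most `N`, its mean `A`
over `B(x,r)` satisfies both `A ≤ Mf(x)`, with `M` the Hardy–Littlewood maximal operator, and `A ≤ c
φ(r) N`. Writing `A = A^β A^(1-β)`, condition (∗) cancels the powers of `φ(r)` and leaves `M_ρ f ≤ H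
(Mf)^β N^(1-β)` (`exists_fracMax_le`). Since `Ψ(t) = Φ(t^(1/β))` and `Ψ⁻¹ = (Φ⁻¹)^β`, estimates for
`M_ρ` in the target space follow from estimates for `M` on the source space.

For `M`, fix a ball `B(x,r)`. Averages about its points over radii below `r` only see `f` on
`B(x,2r)`, and global Orlicz inequalities apply; averages over larger radii are bounded by a
multiple of `φ(r) N`, because `φ` is almost decreasing (`exists_hlMax_le_max`). The global weak
inequality comes from the Vitali covering lemma and convexity. The strong one
(`IsYoung.exists_lintegral_map_hlMax_le`) sums weak inequalities over the levels `b^k`, with `∇₂`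
making the sum geometric.

Necessity tests the operator on `χ_{B(0,t)}`: its norm is at most `c / φ(t)`, while `M_ρ` of it
exceeds a multiple of `ρ(t)` on the ball, so `ρ(t) ≲ η(t) / φ(t) = φ(t)^(β-1)`. The weak bound
suffices for this. -/

namespace OrliczMorrey

/-! ### Young functions and their generalized inverses. -/

section Young

variable {Φ : ℝ≥0∞ → ℝ≥0∞}

theorem IsYoung.map_mul_le (h : IsYoung Φ) {c : ℝ≥0∞} (hc : c ≤ 1) (x : ℝ≥0∞) :
    Φ (c * x) ≤ c * Φ x := by
  lift c to ℝ≥0 using (hc.trans_lt ENNReal.one_lt_top).ne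
  have hc' : c ≤ 1 := by exact_mod_cast hc
  have := h.convex.2 (mem_univ x) (mem_univ 0) (zero_le (a := c)) (zero_le (a := 1 - c))
    (add_tsub_cancel_of_le hc')
  simpa [h.map_zero, ENNReal.smul_def] using this

theorem IsYoung.mono (h : IsYoung Φ) : Monotone Φ := by
  intro x y hxy
  rcases eq_or_ne y ∞ with rfl | hy
  · simp [h.map_top]
  rcases eq_or_ne y 0 with rfl | hy0
  · simp [nonpos_iff_eq_zero.1 hxy]
  have hc : x / y ≤ 1 := ENNReal.div_le_of_le_mul (by simpa using hxy)
  calc Φ x = Φ (x / y * y) := by rw [ENNReal.div_mul_cancel hy0 hy]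
    _ ≤ x / y * Φ y := h.map_mul_le hc y
    _ ≤ 1 * Φ y := by gcongr
    _ = Φ y := one_mul _

theorem IsYoung.measurable (h : IsYoung Φ) : Measurable Φ := h.mono.measurable

/-- The slope `Φ(t)/t` is nondecreasing, by convexity and `Φ(0) = 0`; it is written without division
to cover `0` and `∞`. -/
theorem IsYoung.map_mul_le_mul (h : IsYoung Φ) {a t : ℝ≥0∞} (hat : a ≤ t) :
    Φ a * t ≤ a * Φ t := by
  rcases eq_or_ne a 0 with rfl | ha
  · simp [h.map_zero]
  rcases eq_or_ne t ∞ with rfl | ht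
  · simp [h.map_top, ENNReal.mul_top ha]
  have ht0 : t ≠ 0 := fun h0 => ha (nonpos_iff_eq_zero.1 (h0 ▸ hat))
  have hc : a / t ≤ 1 := ENNReal.div_le_of_le_mul (by simpa using hat)
  calc Φ a * t = Φ (a / t * t) * t := by rw [ENNReal.div_mul_cancel ht0 ht]
    _ ≤ a / t * Φ t * t := by gcongr; exact h.map_mul_le hc t
    _ = a / t * t * Φ t := by ring
    _ = a * Φ t := by rw [ENNReal.div_mul_cancel ht0 ht]

theorem IsYoung.le_mul_div (h : IsYoung Φ) {A : ℝ≥0∞} (hA : 1 ≤ A) (hA' : A ≠ ∞) (x : ℝ≥0∞) :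
    A * Φ (x / A) ≤ Φ x := by
  have hA0 : A ≠ 0 := (one_pos.trans_le hA).ne'
  have := h.map_mul_le (c := A⁻¹) (ENNReal.inv_le_one.2 hA) x
  calc A * Φ (x / A) ≤ A * (A⁻¹ * Φ x) := by
        rw [div_eq_mul_inv, mul_comm x]; gcongr
    _ = Φ x := by rw [← mul_assoc, ENNReal.mul_inv_cancel hA0 hA', one_mul]

theorem IsYoung.le_youngInv (h : IsYoung Φ) {s t : ℝ≥0∞} (hst : Φ t ≤ s) : t ≤ youngInv Φ s := by
  refine le_sInf fun r hr => ?_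
  by_contra! hlt
  exact absurd (hr.trans_le ((h.mono hlt.le).trans hst)) (lt_irrefl s)

theorem IsYoung.lt_map_of_youngInv_lt (h : IsYoung Φ) {s t : ℝ≥0∞} (hst : youngInv Φ s < t) : s < Φ t := by
  by_contra! hlt
  exact absurd hst (h.le_youngInv hlt).not_gt

/-- Left continuity enters here: `Φ ≤ s` strictly below the infimum, and the bound passes to the
limit. The resulting Galois connection `map_le_iff` replaces the inversion of `Φ`. -/
theorem IsYoung.map_youngInv_le (h : IsYoung Φ) (s : ℝ≥0∞) : Φ (youngInv Φ s) ≤ s := by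
  set v := youngInv Φ s with hv
  rcases eq_or_ne v 0 with h0 | h0
  · simp [h0, h.map_zero]
  have : (𝓝[<] v).NeBot := nhdsLT_neBot_of_exists_lt ⟨0, pos_iff_ne_zero.2 h0⟩
  have ht : Tendsto Φ (𝓝[<] v) (𝓝 (Φ v)) :=
    (h.left_continuous v).mono_left (nhdsWithin_mono _ Iio_subset_Iic_self)
  refine le_of_tendsto ht ?_
  filter_upwards [self_mem_nhdsWithin] with r hr
  by_contra! hlt
  exact absurd (sInf_le (show r ∈ {r | s < Φ r} from hlt)) (not_le.2 hr)

theorem IsYoung.map_le_iff (h : IsYoung Φ) {s t : ℝ≥0∞} : Φ t ≤ s ↔ t ≤ youngInv Φ s :=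
  ⟨h.le_youngInv, fun ht => (h.mono ht).trans (h.map_youngInv_le s)⟩

theorem youngInv_mono (Φ : ℝ≥0∞ → ℝ≥0∞) : Monotone (youngInv Φ) :=
  fun _ _ hst => sInf_le_sInf fun _ hr => hst.trans_lt hr

/-- Follows from `c Φ(v/c) ≤ Φ(v)` at `v = Φ⁻¹(cs)`. It moves dimensional constants out of the
argument of `Φ⁻¹`. -/
theorem IsYoung.youngInv_mul_le (h : IsYoung Φ) {c : ℝ≥0∞} (hc : 1 ≤ c) (hc' : c ≠ ∞)
    (s : ℝ≥0∞) : youngInv Φ (c * s) ≤ c * youngInv Φ s := by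
  have hc0 : c ≠ 0 := (one_pos.trans_le hc).ne'
  rw [mul_comm c (youngInv Φ s), ← ENNReal.div_le_iff hc0 hc', ← h.map_le_iff]
  have h1 := (h.le_mul_div hc hc' (youngInv Φ (c * s))).trans (h.map_youngInv_le (c * s))
  exact (ENNReal.mul_le_mul_iff_right hc0 hc').1 h1

theorem IsYoung.youngInv_pos (h : IsYoung Φ) {s : ℝ≥0∞} (hs : 0 < s) : 0 < youngInv Φ s := by
  have h1 : ∀ᶠ r in 𝓝[>] (0 : ℝ≥0∞), Φ r < s := h.tendsto_zero.eventually (gt_mem_nhds hs)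
  obtain ⟨r, hr, hr0⟩ := (h1.and self_mem_nhdsWithin).exists
  exact lt_of_lt_of_le hr0 (h.le_youngInv hr.le)

theorem IsYoung.youngInv_lt_top (h : IsYoung Φ) {s : ℝ≥0∞} (hs : s < ∞) : youngInv Φ s < ∞ := by
  have h1 : ∀ᶠ r in 𝓝[<] (∞ : ℝ≥0∞), s < Φ r := h.tendsto_top.eventually (lt_mem_nhds hs)
  have : (𝓝[<] (∞ : ℝ≥0∞)).NeBot := nhdsLT_neBot_of_exists_lt ⟨0, by simp⟩
  obtain ⟨r, hr, hr0⟩ := (h1.and self_mem_nhdsWithin).exists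
  exact lt_of_le_of_lt (sInf_le hr) hr0

/-- A linear lower bound of a Young function. -/
theorem IsYoung.mul_le_add (h : IsYoung Φ) {s v : ℝ≥0∞} (hsv : s ≤ Φ v) (t : ℝ≥0∞) :
    t * s ≤ v * s + v * Φ t := by
  rcases le_total t v with htv | hvt
  · exact le_add_right (by gcongr)
  · calc t * s ≤ Φ v * t := by rw [mul_comm]; gcongr
      _ ≤ v * Φ t := h.map_mul_le_mul hvt
      _ ≤ _ := le_add_self

end Young

/-! ### Volumes of balls and averages over them. -/

section Balls

variable {n : ℕ}

theorem volume_ball_eq (x : EuclideanSpace ℝ (Fin n)) {r : ℝ} (hr : 0 < r) :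
    volume (Metric.ball x r) = ENNReal.ofReal (r ^ n) *
      volume (Metric.ball (0 : EuclideanSpace ℝ (Fin n)) 1) := by
  simpa using Measure.addHaar_ball_of_pos volume x hr

theorem volume_ball_ne_zero (x : EuclideanSpace ℝ (Fin n)) {r : ℝ} (hr : 0 < r) :
    volume (Metric.ball x r) ≠ 0 := (Metric.measure_ball_pos _ _ hr).ne'

theorem volume_ball_ne_top (x : EuclideanSpace ℝ (Fin n)) (r : ℝ) :
    volume (Metric.ball x r) ≠ ∞ := measure_ball_lt_top.ne

/-- Comparison of `Φ⁻¹(|B|⁻¹)` with `Φ⁻¹(r⁻ⁿ)` for a ball `B` of radius `r`. -/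
theorem IsYoung.exists_youngInv_volume_le (n : ℕ) {Φ : ℝ≥0∞ → ℝ≥0∞} (h : IsYoung Φ) :
    ∃ c : ℝ≥0, 1 ≤ c ∧ ∀ (x : EuclideanSpace ℝ (Fin n)) (r : ℝ), 0 < r →
      youngInv Φ (volume (Metric.ball x r))⁻¹ ≤ c * invAt n Φ r ∧
      invAt n Φ r ≤ c * youngInv Φ (volume (Metric.ball x r))⁻¹ := by
  set w := volume (Metric.ball (0 : EuclideanSpace ℝ (Fin n)) 1) with hw
  have hw0 : w ≠ 0 := volume_ball_ne_zero _ one_pos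
  have hwt : w ≠ ∞ := volume_ball_ne_top _ _
  -- The numbers `|B|⁻¹` and `r⁻ⁿ` differ by the factor `w⁻¹`; `c` dominates this factor and its
  -- inverse, and `c ≥ 1` as `youngInv_mul_le` requires.
  set c : ℝ≥0∞ := max 1 (max w w⁻¹) with hc
  have hct : c ≠ ∞ := by simp [hc, hwt, hw0]
  have hc1 : 1 ≤ c := le_max_left _ _
  have hcw : w ≤ c := (le_max_left _ _).trans (le_max_right _ _)
  have hcw' : w⁻¹ ≤ c := (le_max_right _ _).trans (le_max_right _ _)
  refine ⟨c.toNNReal, by rw [← ENNReal.coe_le_coe, ENNReal.coe_toNNReal hct]; simpa using hc1,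
    fun x r hr => ?_⟩
  rw [ENNReal.coe_toNNReal hct, volume_ball_eq x hr]
  have hrn : 0 < r ^ n := by positivity
  have hR0 : ENNReal.ofReal (r ^ n) ≠ 0 := by simpa using hrn
  rw [invAt, ENNReal.ofReal_inv_of_pos hrn, ENNReal.mul_inv (Or.inl hR0) (Or.inr hw0)]
  constructor
  · refine (youngInv_mono Φ ?_).trans (h.youngInv_mul_le hc1 hct _)
    rw [mul_comm]; gcongr
  · refine (youngInv_mono Φ ?_).trans (h.youngInv_mul_le hc1 hct _)
    calc (ENNReal.ofReal (r ^ n))⁻¹ = w * w⁻¹ * (ENNReal.ofReal (r ^ n))⁻¹ := by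
          rw [ENNReal.mul_inv_cancel hw0 hwt, one_mul]
      _ ≤ c * ((ENNReal.ofReal (r ^ n))⁻¹ * w⁻¹) := by
          rw [mul_assoc, mul_comm w⁻¹]; gcongr

theorem IsYoung.invAt_pos (n : ℕ) {Φ : ℝ≥0∞ → ℝ≥0∞} (h : IsYoung Φ) {r : ℝ} (hr : 0 < r) :
    0 < invAt n Φ r := h.youngInv_pos (by simp; positivity)

theorem IsYoung.invAt_lt_top (n : ℕ) {Φ : ℝ≥0∞ → ℝ≥0∞} (h : IsYoung Φ) (r : ℝ) :
    invAt n Φ r < ∞ := h.youngInv_lt_top (by simp)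

theorem IsYoung.mul_volume_le_one_iff {Φ : ℝ≥0∞ → ℝ≥0∞} (h : IsYoung Φ)
    (x : EuclideanSpace ℝ (Fin n)) {r : ℝ} (hr : 0 < r) {t : ℝ≥0∞} :
    Φ t * volume (Metric.ball x r) ≤ 1 ↔ t ≤ youngInv Φ (volume (Metric.ball x r))⁻¹ := by
  rw [← h.map_le_iff, ← one_div, ENNReal.le_div_iff_mul_le (Or.inl (volume_ball_ne_zero x hr))
    (Or.inl (volume_ball_ne_top x r))]

/-- Averages over balls are controlled by the Luxemburg norm. -/
theorem IsYoung.setLIntegral_ball_le {Φ : ℝ≥0∞ → ℝ≥0∞} (h : IsYoung Φ)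
    {g : EuclideanSpace ℝ (Fin n) → ℝ≥0∞} {x : EuclideanSpace ℝ (Fin n)} {r : ℝ} (hr : 0 < r)
    {l : ℝ≥0∞} (hl0 : l ≠ 0) (hlt : l ≠ ∞) (hg : ∫⁻ y in Metric.ball x r, Φ (g y / l) ≤ 1) :
    ∫⁻ y in Metric.ball x r, g y ≤
      4 * youngInv Φ (volume (Metric.ball x r))⁻¹ * l * volume (Metric.ball x r) := by
  set V := volume (Metric.ball x r) with hV
  have hV0 : V ≠ 0 := volume_ball_ne_zero x hr
  have hVt : V ≠ ∞ := volume_ball_ne_top x r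
  set u := youngInv Φ V⁻¹ with hu
  have hu0 : 0 < u := h.youngInv_pos (by simpa using hVt)
  have hut : u < ∞ := h.youngInv_lt_top (ENNReal.inv_lt_top.2 (pos_iff_ne_zero.2 hV0))
  -- `Φ(u)` may lie strictly below `V⁻¹` if `Φ` jumps at `u`, so the linear bound is taken at `2u`.
  -- Its two summands give the constant `4 = 2 + 2`.
  have hlt2 : V⁻¹ ≤ Φ (2 * u) := by
    refine (h.lt_map_of_youngInv_lt ?_).le
    rw [← hu, two_mul]
    exact ENNReal.lt_add_right hut.ne hu0.ne'
  have h1 : ∀ y, g y ≤ l * V * (2 * u * V⁻¹ + 2 * u * Φ (g y / l)) := fun y =>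
    calc g y = l * V * (g y / l * V⁻¹) := by
          calc g y = (g y / l * l) * (V * V⁻¹) := by
                rw [ENNReal.div_mul_cancel hl0 hlt, ENNReal.mul_inv_cancel hV0 hVt, mul_one]
            _ = _ := by ring
      _ ≤ _ := by gcongr; exact h.mul_le_add hlt2 _
  calc ∫⁻ y in Metric.ball x r, g y
      ≤ ∫⁻ y in Metric.ball x r, l * V * (2 * u * V⁻¹ + 2 * u * Φ (g y / l)) :=
        lintegral_mono h1
    _ = l * V * (2 * u * V⁻¹ * V + 2 * u * ∫⁻ y in Metric.ball x r, Φ (g y / l)) := by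
        rw [lintegral_const_mul' _ _ (ENNReal.mul_ne_top hlt hVt), lintegral_add_left
          measurable_const, setLIntegral_const,
          lintegral_const_mul' _ _ (ENNReal.mul_ne_top (by simp) hut.ne)]
    _ ≤ l * V * (2 * u + 2 * u * 1) := by
        refine mul_le_mul_right (add_le_add (le_of_eq ?_) (mul_le_mul_right hg _)) _
        rw [mul_assoc (2 * u), ENNReal.inv_mul_cancel hV0 hVt, mul_one]
    _ = _ := by ring

end Balls

/-! ### Weak and strong inequalities for the Hardy–Littlewood maximal function. -/

section Maximal

variable {n : ℕ}

/-- The Hardy–Littlewood maximal function of a `[0,∞]`-valued function. -/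
noncomputable def hlMax (g : EuclideanSpace ℝ (Fin n) → ℝ≥0∞) (x : EuclideanSpace ℝ (Fin n)) :
    ℝ≥0∞ :=
  ⨆ r : ℝ, ⨆ _ : 0 < r, (∫⁻ y in Metric.ball x r, g y) / volume (Metric.ball x r)

/-- An open ball is the increasing union of smaller concentric balls. The slack `r - s` lets the
centre move, which gives lower semicontinuity. -/
theorem exists_lt_of_lt_setLIntegral_ball (g : EuclideanSpace ℝ (Fin n) → ℝ≥0∞)
    (x : EuclideanSpace ℝ (Fin n)) (r : ℝ) {c : ℝ≥0∞} (hc : c < ∫⁻ y in Metric.ball x r, g y) :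
    ∃ s < r, c < ∫⁻ y in Metric.ball x s, g y := by
  obtain ⟨u, hu, hur, hut⟩ := exists_seq_strictMono_tendsto r
  have hU : Metric.ball x r = ⋃ k, Metric.ball x (u k) := by
    ext y
    simp only [mem_iUnion, Metric.mem_ball]
    constructor
    · intro hy
      exact (hut.eventually (lt_mem_nhds hy)).exists
    · rintro ⟨k, hk⟩
      exact hk.trans (hur k)
  rw [hU, setLIntegral_iUnion_of_directed] at hc
  · obtain ⟨k, hk⟩ := lt_iSup_iff.1 hc
    exact ⟨u k, hur k, hk⟩
  · exact Monotone.directed_le fun i j hij => Metric.ball_subset_ball (hu.monotone hij)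

theorem lowerSemicontinuous_setLIntegral_ball (g : EuclideanSpace ℝ (Fin n) → ℝ≥0∞) (r : ℝ) :
    LowerSemicontinuous fun x => ∫⁻ y in Metric.ball x r, g y := by
  intro x c hc
  obtain ⟨s, hsr, hs⟩ := exists_lt_of_lt_setLIntegral_ball g x r hc
  filter_upwards [Metric.ball_mem_nhds x (sub_pos.2 hsr)] with z hz
  refine hs.trans_le (lintegral_mono_set (Metric.ball_subset_ball' ?_))
  rw [Metric.mem_ball, dist_comm] at hz
  linarith

/-- The weight `a` is `1` for `hlMax` and `ρ` for `fracMax`, so both are measurable with open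
superlevel sets. -/
theorem lowerSemicontinuous_iSup_ball (a : ℝ → ℝ≥0∞) (g : EuclideanSpace ℝ (Fin n) → ℝ≥0∞) :
    LowerSemicontinuous fun x : EuclideanSpace ℝ (Fin n) => ⨆ r : ℝ, ⨆ _ : 0 < r,
      a r / volume (Metric.ball x r) * ∫⁻ y in Metric.ball x r, g y := by
  refine lowerSemicontinuous_iSup fun r => lowerSemicontinuous_iSup fun hr => ?_
  have hv : ∀ x : EuclideanSpace ℝ (Fin n), volume (Metric.ball x r) =
      volume (Metric.ball (0 : EuclideanSpace ℝ (Fin n)) r) := fun x =>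
    Measure.addHaar_ball_center volume x r
  simp only [hv]
  generalize a r / volume (Metric.ball (0 : EuclideanSpace ℝ (Fin n)) r) = d
  intro x c hc
  have hd : d ≠ 0 := by rintro rfl; simp at hc
  rcases eq_or_ne d ∞ with rfl | hdt
  · have h0 : 0 < ∫⁻ y in Metric.ball x r, g y := by
      rw [pos_iff_ne_zero]; intro h; simp [h] at hc
    filter_upwards [lowerSemicontinuous_setLIntegral_ball g r x 0 h0] with z hz
    rw [ENNReal.top_mul hz.ne']
    exact hc.trans_le le_top
  · have h1 : c / d < ∫⁻ y in Metric.ball x r, g y :=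
      ENNReal.div_lt_of_lt_mul' hc
    filter_upwards [lowerSemicontinuous_setLIntegral_ball g r x _ h1] with z hz
    have hz' : c / d < ∫⁻ y in Metric.ball z r, g y := hz
    rw [ENNReal.div_lt_iff (Or.inl hd) (Or.inl hdt), mul_comm] at hz'
    exact hz'

theorem lowerSemicontinuous_hlMax (g : EuclideanSpace ℝ (Fin n) → ℝ≥0∞) :
    LowerSemicontinuous (hlMax g) := by
  simpa only [one_div, div_eq_mul_inv, one_mul, mul_comm] using!
    lowerSemicontinuous_iSup_ball (fun _ => 1) g

theorem measurable_hlMax (g : EuclideanSpace ℝ (Fin n) → ℝ≥0∞) : Measurable (hlMax g) :=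
  (lowerSemicontinuous_hlMax g).measurable

theorem le_hlMax (g : EuclideanSpace ℝ (Fin n) → ℝ≥0∞) (x : EuclideanSpace ℝ (Fin n)) {r : ℝ}
    (hr : 0 < r) : (∫⁻ y in Metric.ball x r, g y) / volume (Metric.ball x r) ≤ hlMax g x :=
  le_iSup₂_of_le r hr le_rfl

/-- The weak type `(1,1)` inequality for the Hardy–Littlewood maximal function. -/
theorem mul_volume_lt_hlMax_le (g : EuclideanSpace ℝ (Fin n) → ℝ≥0∞) (c : ℝ≥0∞) :
    c * volume {x | c < hlMax g x} ≤ 4 ^ n * ∫⁻ y, g y := by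
  have hopen : IsOpen {x | c < hlMax g x} := (lowerSemicontinuous_hlMax g).isOpen_preimage c
  -- Inner regularity reduces the claim to compact sets, hence to finitely many balls.
  rw [hopen.measure_eq_iSup_isCompact, ENNReal.mul_iSup]
  refine iSup_le fun K => ?_
  rw [ENNReal.mul_iSup]
  refine iSup_le fun hKs => ?_
  rw [ENNReal.mul_iSup]
  refine iSup_le fun hK => ?_
  have hex : ∀ x : K, ∃ r : ℝ, 0 < r ∧
      c * volume (Metric.ball (x : EuclideanSpace ℝ (Fin n)) r) ≤
        ∫⁻ y in Metric.ball (x : EuclideanSpace ℝ (Fin n)) r, g y := by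
    intro x
    have hx : c < hlMax g x := hKs x.2
    obtain ⟨r, hr⟩ := lt_iSup_iff.1 hx
    obtain ⟨hr0, hr⟩ := lt_iSup_iff.1 hr
    refine ⟨r, hr0, ?_⟩
    rw [ENNReal.lt_div_iff_mul_lt (Or.inl (volume_ball_ne_zero _ hr0))
      (Or.inl (volume_ball_ne_top _ r))] at hr
    exact hr.le
  choose r hr0 hr using hex
  obtain ⟨t, ht⟩ := hK.elim_finite_subcover (fun x : K => Metric.ball (x : EuclideanSpace ℝ (Fin n))
    (r x)) (fun _ => Metric.isOpen_ball) fun x hx =>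
      mem_iUnion.2 ⟨⟨x, hx⟩, Metric.mem_ball_self (hr0 _)⟩
  obtain ⟨R, hR⟩ : ∃ R, ∀ a ∈ (t : Set K), r a ≤ R := by
    obtain ⟨R, hR⟩ := (t.finite_toSet.image r).bddAbove
    exact ⟨R, fun a ha => hR (mem_image_of_mem r ha)⟩
  -- The covering lemma accepts any enlargement factor above `3`; the choice `4` produces the
  -- constant `4 ^ n`.
  obtain ⟨u, hut, hdisj, hcov⟩ := Vitali.exists_disjoint_subfamily_covering_enlargement_closedBall
    (t : Set K) (fun x => (x : EuclideanSpace ℝ (Fin n))) r R hR 4 (by norm_num)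
  have hufin : u.Finite := t.finite_toSet.subset hut
  lift u to Finset K using hufin
  have hball : ∀ b : K, volume (Metric.closedBall (b : EuclideanSpace ℝ (Fin n)) (4 * r b)) =
      4 ^ n * volume (Metric.ball (b : EuclideanSpace ℝ (Fin n)) (r b)) := by
    intro b
    rw [Measure.addHaar_closedBall _ _ (by have := hr0 b; positivity), finrank_euclideanSpace_fin,
      volume_ball_eq _ (hr0 b), mul_pow, ENNReal.ofReal_mul (by positivity), mul_assoc,
      ENNReal.ofReal_pow (by norm_num)]
    norm_num
  have hKcov : K ⊆ ⋃ b ∈ u, Metric.closedBall (b : EuclideanSpace ℝ (Fin n)) (4 * r b) := by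
    intro x hx
    obtain ⟨a, ha, hxa⟩ := mem_iUnion₂.1 (ht hx)
    obtain ⟨b, hb, hab⟩ := hcov a ha
    exact mem_iUnion₂.2 ⟨b, hb, hab (Metric.ball_subset_closedBall hxa)⟩
  calc c * volume K ≤ c * ∑ b ∈ u, volume (Metric.closedBall (b : EuclideanSpace ℝ (Fin n))
        (4 * r b)) := by
        gcongr
        exact (measure_mono hKcov).trans (measure_biUnion_finset_le _ _)
    _ = 4 ^ n * ∑ b ∈ u, c * volume (Metric.ball (b : EuclideanSpace ℝ (Fin n)) (r b)) := by
        simp only [hball, ← Finset.mul_sum]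
        ring
    _ ≤ 4 ^ n * ∑ b ∈ u, ∫⁻ y in Metric.ball (b : EuclideanSpace ℝ (Fin n)) (r b), g y := by
        gcongr with b
        exact hr b
    _ = 4 ^ n * ∫⁻ y in ⋃ b ∈ u, Metric.ball (b : EuclideanSpace ℝ (Fin n)) (r b), g y := by
        rw [lintegral_biUnion_finset _ fun _ _ => measurableSet_ball]
        intro a ha b hb hab
        exact (hdisj ha hb hab).mono Metric.ball_subset_closedBall Metric.ball_subset_closedBall
    _ ≤ 4 ^ n * ∫⁻ y, g y := by
        gcongr
        exact Measure.restrict_le_self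

/-- The truncated weak type inequality. -/
theorem mul_volume_two_mul_lt_hlMax_le (g : EuclideanSpace ℝ (Fin n) → ℝ≥0∞) (c : ℝ≥0∞) :
    c * volume {x | 2 * c < hlMax g x} ≤ 4 ^ n * ∫⁻ y, {t | c < t}.indicator id (g y) := by
  refine le_trans ?_ (mul_volume_lt_hlMax_le _ c)
  refine mul_le_mul_right (measure_mono fun x hx => ?_) _
  simp only [mem_ofPred_eq] at hx ⊢
  -- Pointwise `g ≤ c + g χ_{g > c}`, and the average of the constant `c` is `c`; the other half of
  -- the level `2c` must come from the truncation.
  have hle : hlMax g x ≤ c + hlMax (fun y => {t | c < t}.indicator id (g y)) x := by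
    refine iSup₂_le fun r hr => ?_
    have hV0 := volume_ball_ne_zero x hr
    have hVt := volume_ball_ne_top x r
    have h1 : ∫⁻ y in Metric.ball x r, g y ≤ c * volume (Metric.ball x r) +
        ∫⁻ y in Metric.ball x r, {t | c < t}.indicator id (g y) := by
      rw [← setLIntegral_const, ← lintegral_add_left measurable_const]
      refine lintegral_mono fun y => ?_
      by_cases hy : c < g y
      · simp [hy]
      · exact le_add_right (not_lt.1 hy)
    calc _ ≤ (c * volume (Metric.ball x r) +
          ∫⁻ y in Metric.ball x r, {t | c < t}.indicator id (g y)) / volume (Metric.ball x r) := by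
          gcongr
      _ = c + (∫⁻ y in Metric.ball x r, {t | c < t}.indicator id (g y)) /
            volume (Metric.ball x r) := by
          rw [ENNReal.add_div, ENNReal.mul_div_cancel_right hV0 hVt]
      _ ≤ _ := by gcongr; exact le_hlMax _ x hr
  have h2 := hx.trans_le hle
  rw [two_mul] at h2
  exact lt_of_add_lt_add_left h2

/-- The weak type inequality of the maximal function in Orlicz spaces, in modular form. -/
theorem IsYoung.map_mul_volume_lt_hlMax_le {Φ : ℝ≥0∞ → ℝ≥0∞} (h : IsYoung Φ)
    {g : EuclideanSpace ℝ (Fin n) → ℝ≥0∞} (hg : AEMeasurable g) {c : ℝ≥0∞} (hc : c ≠ ∞) :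
    Φ c * volume {x | 2 * c < hlMax g x} ≤ 4 ^ n * ∫⁻ y, Φ (g y) := by
  rcases eq_or_ne c 0 with rfl | hc0
  · simp [h.map_zero]
  -- After multiplication by `c`, the monotone slope `Φ(c) t ≤ c Φ(t)` for `t > c` compares the
  -- truncated integral with the modular.
  refine (ENNReal.mul_le_mul_iff_right hc0 hc).1 ?_
  calc c * (Φ c * volume {x | 2 * c < hlMax g x})
      = Φ c * (c * volume {x | 2 * c < hlMax g x}) := by ring
    _ ≤ Φ c * (4 ^ n * ∫⁻ y, {t | c < t}.indicator id (g y)) := by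
        gcongr Φ c * ?_; exact mul_volume_two_mul_lt_hlMax_le g c
    _ = 4 ^ n * (Φ c * ∫⁻ y, {t | c < t}.indicator id (g y)) := by ring
    _ ≤ 4 ^ n * (c * ∫⁻ y, Φ (g y)) := by
        gcongr 4 ^ n * ?_
        have hm : AEMeasurable fun y => {t | c < t}.indicator id (g y) :=
          (measurable_id.indicator measurableSet_Ioi).comp_aemeasurable hg
        rw [← lintegral_const_mul' c _ hc, ← lintegral_const_mul'' _ hm]
        refine lintegral_mono fun y => ?_
        by_cases hy : c < g y
        · simpa [hy] using h.map_mul_le_mul hy.le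
        · simp [hy]
    _ = c * (4 ^ n * ∫⁻ y, Φ (g y)) := by ring

/-- The `∇₂` inequality says that `Φ(r)/r` at least doubles when `r` is replaced by `b r`; this is
iterated `k` times. -/
theorem map_zpow_sub_div_le {Φ : ℝ≥0∞ → ℝ≥0∞} {b : ℝ≥0∞} (hb0 : b ≠ 0) (hbt : b ≠ ∞)
    (hb : ∀ r, Φ r ≤ Φ (b * r) / (2 * b)) (m : ℤ) (k : ℕ) :
    Φ (b ^ (m - k)) / b ^ (m - k) ≤ 2⁻¹ ^ k * (Φ (b ^ m) / b ^ m) := by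
  induction k with
  | zero => simp
  | succ k ih =>
    have hz : b ^ (m - k) = b * b ^ (m - (k + 1 : ℕ)) := by
      conv_rhs => enter [1]; rw [← zpow_one b]
      rw [← ENNReal.zpow_add hb0 hbt]
      congr 1
      push_cast
      ring
    calc Φ (b ^ (m - (k + 1 : ℕ))) / b ^ (m - (k + 1 : ℕ))
        ≤ Φ (b * b ^ (m - (k + 1 : ℕ))) / (2 * b) / b ^ (m - (k + 1 : ℕ)) := by
          gcongr; exact hb _
      _ = 2⁻¹ * (Φ (b ^ (m - k)) / b ^ (m - k)) := by
          rw [hz, div_eq_mul_inv, div_eq_mul_inv, div_eq_mul_inv,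
            ENNReal.mul_inv (Or.inl (by simp)) (Or.inl (by simp)),
            ENNReal.mul_inv (Or.inl hb0) (Or.inl hbt)]
          ring
      _ ≤ 2⁻¹ * (2⁻¹ ^ k * (Φ (b ^ m) / b ^ m)) := by gcongr
      _ = _ := by ring

theorem IsYoung.tsum_zpow_indicator_le {Φ : ℝ≥0∞ → ℝ≥0∞} (h : IsYoung Φ) {b : ℝ≥0∞} (hb1 : 1 < b)
    (hbt : b ≠ ∞) (hb : ∀ r, Φ r ≤ Φ (b * r) / (2 * b)) (t : ℝ≥0∞) :
    ∑' k : ℤ, Φ (b ^ k) / b ^ k * {t | b ^ k < t}.indicator id t ≤ 2 * Φ t := by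
  have hb0 : b ≠ 0 := (one_pos.trans hb1).ne'
  rcases eq_or_ne t 0 with rfl | ht0
  · simp
  rcases eq_or_ne t ∞ with rfl | htt
  · simp [h.map_top]
  obtain ⟨m, hm, hm'⟩ := ENNReal.exists_mem_Ioc_zpow ht0 htt hb1 hbt
  have hinj : Function.Injective fun j : ℕ => m - (j : ℤ) := fun i j hij => by
    simpa using hij
  -- Only the levels `b^k < t` contribute, that is `k = m - j` with `j ≥ 0`; the geometric series
  -- over `j` sums to `2`.
  rw [← hinj.tsum_eq]
  · calc ∑' j : ℕ, Φ (b ^ (m - (j : ℤ))) / b ^ (m - (j : ℤ)) *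
          {t | b ^ (m - (j : ℤ)) < t}.indicator id t
        ≤ ∑' j : ℕ, 2⁻¹ ^ j * (Φ (b ^ m) / b ^ m * t) := by
          refine ENNReal.tsum_le_tsum fun j => ?_
          rw [← mul_assoc]
          gcongr
          · exact map_zpow_sub_div_le hb0 hbt hb m j
          · exact indicator_le_self _ _ _
      _ = 2 * (Φ (b ^ m) * t / b ^ m) := by
          rw [ENNReal.tsum_mul_right, ENNReal.tsum_geometric, ENNReal.one_sub_inv_two, inv_inv,
            ENNReal.mul_div_right_comm]
      _ ≤ 2 * Φ t := by
          gcongr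
          refine ENNReal.div_le_of_le_mul ?_
          rw [mul_comm (Φ t)]
          exact h.map_mul_le_mul hm.le
  · intro k hk
    have hk' : b ^ k < t := by
      by_contra hlt
      simp [hlt] at hk
    have hkm : k < m + 1 := by
      by_contra! hle
      exact absurd (hk'.trans_le (hm'.trans (ENNReal.zpow_le_of_le hb1.le hle))) (lt_irrefl _)
    exact ⟨(m - k).toNat, by simp only; omega⟩

/-- A discrete layer-cake bound. For finite `t > 0` the single term with `b^m < t/2 ≤ b^(m+1)`
suffices; at `t = ∞` every level contributes and `Φ(b^k) → ∞`. -/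
theorem IsYoung.map_le_tsum_zpow {Φ : ℝ≥0∞ → ℝ≥0∞} (h : IsYoung Φ) {b : ℝ≥0∞} (hb1 : 1 < b)
    (hbt : b ≠ ∞) (t : ℝ≥0∞) :
    Φ (t / (2 * b)) ≤ ∑' k : ℤ, {t | 2 * b ^ k < t}.indicator (fun _ => Φ (b ^ k)) t := by
  have hb0 : b ≠ 0 := (one_pos.trans hb1).ne'
  rcases eq_or_ne t 0 with rfl | ht0
  · simp [h.map_zero]
  rcases eq_or_ne t ∞ with rfl | htt
  · have hpow : Tendsto (fun k : ℕ => b ^ k) atTop (𝓝[<] ∞) := by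
      refine tendsto_nhdsWithin_iff.2 ⟨ENNReal.tendsto_pow_atTop_nhds_top_iff.2 hb1, ?_⟩
      exact .of_forall fun k => ENNReal.pow_lt_top hbt.lt_top
    refine le_top.trans (le_of_tendsto' (h.tendsto_top.comp hpow) fun k => ?_)
    refine le_trans ?_ (ENNReal.le_tsum (k : ℤ))
    have : 2 * b ^ (k : ℤ) < ∞ :=
      ENNReal.mul_lt_top (by simp) (ENNReal.zpow_lt_top hb0 hbt _)
    rw [indicator_of_mem (by exact this)]
    simp
  obtain ⟨m, hm, hm'⟩ := ENNReal.exists_mem_Ioc_zpow (x := t / 2) (by simp [ht0])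
    (ENNReal.div_ne_top htt (by simp)) hb1 hbt
  refine le_trans ?_ (ENNReal.le_tsum m)
  rw [indicator_of_mem]
  · refine h.mono ?_
    refine ENNReal.div_le_of_le_mul ?_
    rw [ENNReal.zpow_add hb0 hbt, zpow_one, ENNReal.div_le_iff (by simp) (by simp)] at hm'
    exact hm'.trans_eq (by ring)
  · rw [ENNReal.lt_div_iff_mul_lt (by simp) (by simp)] at hm
    rwa [mem_ofPred_eq, mul_comm]

/-- The strong type inequality of the maximal function under the `∇₂`-condition. -/
theorem IsYoung.exists_lintegral_map_hlMax_le (n : ℕ) {Φ : ℝ≥0∞ → ℝ≥0∞} (h : IsYoung Φ)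
    (hΦ : Nabla2 Φ) :
    ∃ b : ℝ≥0, 1 ≤ b ∧ ∀ g : EuclideanSpace ℝ (Fin n) → ℝ≥0∞, AEMeasurable g →
      ∫⁻ x, Φ (hlMax g x / b) ≤ 2 * 4 ^ n * ∫⁻ x, Φ (g x) := by
  obtain ⟨b, hb1, hb⟩ := hΦ
  refine ⟨2 * b, ?_, fun g hg => ?_⟩
  · calc (1 : ℝ≥0) ≤ 2 * 1 := by norm_num
      _ ≤ 2 * b := by gcongr
  have hb1' : (1 : ℝ≥0∞) < b := by exact_mod_cast hb1
  have hb0 : (b : ℝ≥0∞) ≠ 0 := (one_pos.trans hb1').ne'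
  have hp0 : ∀ k : ℤ, (b : ℝ≥0∞) ^ k ≠ 0 := fun k => (ENNReal.zpow_pos hb0 (by simp) k).ne'
  have hpt : ∀ k : ℤ, (b : ℝ≥0∞) ^ k ≠ ∞ := fun k => ENNReal.zpow_ne_top hb0 (by simp) k
  have hM := measurable_hlMax g
  have hmi : ∀ k : ℤ, AEMeasurable fun y => {t | (b : ℝ≥0∞) ^ k < t}.indicator id (g y) :=
    fun k => (measurable_id.indicator measurableSet_Ioi).comp_aemeasurable hg
  have hset : ∀ k : ℤ, MeasurableSet {x | 2 * (b : ℝ≥0∞) ^ k < hlMax g x} := fun k =>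
    measurableSet_lt measurable_const hM
  -- Decompose into the levels `2 b^k`, apply the truncated weak inequality at each one, and sum
  -- over `k` inside the integral.
  calc ∫⁻ x, Φ (hlMax g x / (2 * b : ℝ≥0))
      ≤ ∫⁻ x, ∑' k : ℤ, {x | 2 * (b : ℝ≥0∞) ^ k < hlMax g x}.indicator
          (fun _ => Φ ((b : ℝ≥0∞) ^ k)) x := by
        refine lintegral_mono fun x => ?_
        rw [ENNReal.coe_mul]
        exact h.map_le_tsum_zpow hb1' (by simp) _
    _ = ∑' k : ℤ, Φ ((b : ℝ≥0∞) ^ k) * volume {x | 2 * (b : ℝ≥0∞) ^ k < hlMax g x} := by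
        rw [lintegral_tsum fun k => (measurable_const.indicator (hset k)).aemeasurable]
        simp only [lintegral_indicator_const (hset _)]
    _ ≤ ∑' k : ℤ, 4 ^ n * ∫⁻ y, Φ ((b : ℝ≥0∞) ^ k) / (b : ℝ≥0∞) ^ k *
          {t | (b : ℝ≥0∞) ^ k < t}.indicator id (g y) := by
        refine ENNReal.tsum_le_tsum fun k => ?_
        rw [lintegral_const_mul'' _ (hmi k)]
        calc Φ ((b : ℝ≥0∞) ^ k) * volume {x | 2 * (b : ℝ≥0∞) ^ k < hlMax g x}
            = Φ ((b : ℝ≥0∞) ^ k) / (b : ℝ≥0∞) ^ k *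
              ((b : ℝ≥0∞) ^ k * volume {x | 2 * (b : ℝ≥0∞) ^ k < hlMax g x}) := by
              rw [← mul_assoc, ENNReal.div_mul_cancel (hp0 k) (hpt k)]
          _ ≤ Φ ((b : ℝ≥0∞) ^ k) / (b : ℝ≥0∞) ^ k *
              (4 ^ n * ∫⁻ y, {t | (b : ℝ≥0∞) ^ k < t}.indicator id (g y)) := by
              exact mul_le_mul_right (mul_volume_two_mul_lt_hlMax_le g _) _
          _ = _ := by ring
    _ = 4 ^ n * ∫⁻ y, ∑' k : ℤ, Φ ((b : ℝ≥0∞) ^ k) / (b : ℝ≥0∞) ^ k *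
          {t | (b : ℝ≥0∞) ^ k < t}.indicator id (g y) := by
        rw [ENNReal.tsum_mul_left, lintegral_tsum fun k => (hmi k).const_mul _]
    _ ≤ 4 ^ n * ∫⁻ y, 2 * Φ (g y) := by
        gcongr with y
        exact h.tsum_zpow_indicator_le hb1' (by simp) hb _
    _ = 2 * 4 ^ n * ∫⁻ x, Φ (g x) := by
        rw [lintegral_const_mul' _ _ (by simp)]
        ring

end Maximal

/-! ### Maximal inequalities localized to balls. -/

section Local

variable {n : ℕ} {Φ : ℝ≥0∞ → ℝ≥0∞} {φ : ℝ → ℝ}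

/-- The ratio `φ(r) / Φ⁻¹(r⁻ⁿ)`. -/
noncomputable def morreyScale (n : ℕ) (Φ : ℝ≥0∞ → ℝ≥0∞) (φ : ℝ → ℝ) (r : ℝ) : ℝ≥0∞ :=
  ENNReal.ofReal (φ r) / invAt n Φ r

theorem morreyScale_ne_zero (h : IsYoung Φ) {r : ℝ} (hr : 0 < φ r) : morreyScale n Φ φ r ≠ 0 :=
  (ENNReal.div_pos (by simpa using hr) (h.invAt_lt_top n r).ne).ne'

theorem morreyScale_ne_top (h : IsYoung Φ) {r : ℝ} (hr : 0 < r) :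
    morreyScale n Φ φ r ≠ ∞ :=
  ENNReal.div_ne_top ENNReal.ofReal_ne_top (h.invAt_pos n hr).ne'

theorem morreyScale_mul_invAt (h : IsYoung Φ) {r : ℝ} (hr : 0 < r) :
    morreyScale n Φ φ r * invAt n Φ r = ENNReal.ofReal (φ r) :=
  ENNReal.div_mul_cancel (h.invAt_pos n hr).ne' (h.invAt_lt_top n r).ne

/-- The modular form of the bound `‖g‖ ≤ N` in `𝓜^{Φ,φ}`. -/
def MorreyModular (Φ : ℝ≥0∞ → ℝ≥0∞) (φ : ℝ → ℝ) (N : ℝ≥0∞)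
    (g : EuclideanSpace ℝ (Fin n) → ℝ≥0∞) : Prop :=
  ∀ (x : EuclideanSpace ℝ (Fin n)) (r : ℝ), 0 < r →
    ∫⁻ y in Metric.ball x r, Φ (g y / (morreyScale n Φ φ r * N)) ≤ 1

theorem exists_setLIntegral_div_volume_le (n : ℕ) (h : IsYoung Φ) (hφ : ClassG n Φ φ) :
    ∃ c : ℝ≥0, ∀ N : ℝ≥0∞, N ≠ 0 → N ≠ ∞ → ∀ g : EuclideanSpace ℝ (Fin n) → ℝ≥0∞,
      MorreyModular Φ φ N g → ∀ x r, 0 < r →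
        (∫⁻ y in Metric.ball x r, g y) / volume (Metric.ball x r) ≤
          c * (ENNReal.ofReal (φ r) * N) := by
  obtain ⟨c, -, hc⟩ := h.exists_youngInv_volume_le n
  refine ⟨4 * c, fun N hN0 hNt g hg x r hr => ?_⟩
  have ha0 := morreyScale_ne_zero (n := n) h (hφ.pos r hr)
  have hat := morreyScale_ne_top (n := n) (φ := φ) h hr
  refine ENNReal.div_le_of_le_mul ?_
  refine (h.setLIntegral_ball_le hr (mul_ne_zero ha0 hN0) (ENNReal.mul_ne_top hat hNt)
    (hg x r hr)).trans ?_
  calc _ ≤ 4 * (c * invAt n Φ r) * (morreyScale n Φ φ r * N) * volume (Metric.ball x r) := by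
        gcongr; exact (hc x r hr).1
    _ = 4 * c * (morreyScale n Φ φ r * invAt n Φ r * N) * volume (Metric.ball x r) := by ring
    _ = _ := by
        rw [morreyScale_mul_invAt h hr]
        push_cast
        ring

/-- The second condition of `ClassG` says that `morreyScale / r^n` is almost decreasing, which gives
doubling with factor `c 2^n`. -/
theorem exists_morreyScale_two_mul_le (h : IsYoung Φ) (hφ : ClassG n Φ φ) :
    ∃ c : ℝ≥0, ∀ r, 0 < r → morreyScale n Φ φ (2 * r) ≤ c * morreyScale n Φ φ r := by
  obtain ⟨c, -, hc⟩ := hφ.almostDecreasing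
  refine ⟨c * 2 ^ n, fun r hr => ?_⟩
  have h1 : ∀ s, 0 < s → ENNReal.ofReal (φ s) / (invAt n Φ s * ENNReal.ofReal (s ^ n)) =
      morreyScale n Φ φ s / ENNReal.ofReal (s ^ n) := fun s hs => by
    rw [morreyScale, div_eq_mul_inv, div_eq_mul_inv, div_eq_mul_inv, mul_assoc,
      ENNReal.mul_inv (Or.inl (h.invAt_pos n hs).ne') (Or.inl (h.invAt_lt_top n s).ne)]
  have h2 := hc r (2 * r) hr (by linarith)
  simp only at h2
  have hR0 : ENNReal.ofReal (r ^ n) ≠ 0 := by simp; positivity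
  have hRt : ENNReal.ofReal (r ^ n) ≠ ∞ := ENNReal.ofReal_ne_top
  have h2n : ENNReal.ofReal ((2 * r) ^ n) = 2 ^ n * ENNReal.ofReal (r ^ n) := by
    rw [mul_pow, ENNReal.ofReal_mul (by positivity), ENNReal.ofReal_pow (by norm_num)]
    norm_num
  rw [h1 _ (by positivity), h1 _ hr, h2n, ENNReal.div_le_iff
    (mul_ne_zero (by simp) hR0) (ENNReal.mul_ne_top (by simp) hRt)] at h2
  refine h2.trans_eq ?_
  calc (c : ℝ≥0∞) * (morreyScale n Φ φ r / ENNReal.ofReal (r ^ n)) * (2 ^ n * ENNReal.ofReal (r ^ n))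
      = c * 2 ^ n * (morreyScale n Φ φ r / ENNReal.ofReal (r ^ n) * ENNReal.ofReal (r ^ n)) := by
        ring
    _ = _ := by rw [ENNReal.div_mul_cancel hR0 hRt]; push_cast; rfl

/-- Localization of the maximal function to a ball. -/
theorem exists_hlMax_le_max (n : ℕ) (h : IsYoung Φ) (hφ : ClassG n Φ φ)
    (hφd : AlmostDecreasing fun t => ENNReal.ofReal (φ t)) :
    ∃ K : ℝ≥0, 1 ≤ K ∧ ∀ N : ℝ≥0∞, N ≠ 0 → N ≠ ∞ → ∀ g : EuclideanSpace ℝ (Fin n) → ℝ≥0∞,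
      MorreyModular Φ φ N g → ∀ x r, 0 < r → ∃ D : ℝ≥0∞,
        (∀ y ∈ Metric.ball x r,
          hlMax g y ≤ max (hlMax ((Metric.ball x (2 * r)).indicator g) y) D) ∧
        Φ (D / (K * (morreyScale n Φ φ r * N))) * volume (Metric.ball x r) ≤ 1 ∧
        ∫⁻ y, Φ ((Metric.ball x (2 * r)).indicator g y / (K * (morreyScale n Φ φ r * N))) ≤ 1 := by
  obtain ⟨c₀, -, hc₀⟩ := h.exists_youngInv_volume_le n
  obtain ⟨c₁, hc₁⟩ := exists_setLIntegral_div_volume_le n h hφ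
  obtain ⟨c₂, hc₂⟩ := exists_morreyScale_two_mul_le h hφ
  obtain ⟨c₃, -, hc₃⟩ := hφd
  -- `c₂` pays for passing from `B(x,2r)` to `B(x,r)`; `c₀ c₁ c₃` brings the large-radius bound `D`
  -- below `Φ⁻¹(|B|⁻¹)` after scaling.
  refine ⟨max 1 (max c₂ (c₀ * c₁ * c₃)), le_max_left _ _, fun N hN0 hNt g hg x r hr => ?_⟩
  set K : ℝ≥0 := max 1 (max c₂ (c₀ * c₁ * c₃)) with hK
  have hK2 : (c₂ : ℝ≥0∞) ≤ K := by
    exact_mod_cast (le_max_left c₂ (c₀ * c₁ * c₃)).trans (le_max_right _ _)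
  have hK3 : (c₀ * c₁ * c₃ : ℝ≥0∞) ≤ K := by
    exact_mod_cast (le_max_right c₂ (c₀ * c₁ * c₃)).trans (le_max_right _ _)
  refine ⟨c₁ * (c₃ * ENNReal.ofReal (φ r) * N), fun y hy => ?_, ?_, ?_⟩
  · refine iSup₂_le fun s hs => ?_
    rcases lt_or_ge s r with hsr | hrs
    · refine le_max_of_le_left (le_trans (le_of_eq ?_) (le_hlMax _ y hs))
      congr 1
      refine setLIntegral_congr_fun measurableSet_ball fun z hz => ?_
      rw [indicator_of_mem]
      rw [Metric.mem_ball] at *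
      linarith [dist_triangle z y x]
    · refine le_max_of_le_right ((hc₁ N hN0 hNt g hg y s hs).trans ?_)
      gcongr
      exact hc₃ r s hr hrs
  · rw [h.mul_volume_le_one_iff x hr]
    have hinv := (hc₀ x r hr).2
    refine ENNReal.div_le_of_le_mul ?_
    calc c₁ * (c₃ * ENNReal.ofReal (φ r) * N)
        = c₁ * c₃ * invAt n Φ r * (morreyScale n Φ φ r * N) := by
          rw [← morreyScale_mul_invAt (n := n) h hr]
          ring
      _ ≤ c₁ * c₃ * (c₀ * youngInv Φ (volume (Metric.ball x r))⁻¹) * (morreyScale n Φ φ r * N) := by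
          gcongr
      _ = youngInv Φ (volume (Metric.ball x r))⁻¹ * (c₀ * c₁ * c₃ * (morreyScale n Φ φ r * N)) := by
          ring
      _ ≤ _ := by gcongr
  · refine le_trans ?_ (hg x (2 * r) (by positivity))
    rw [← lintegral_indicator measurableSet_ball]
    refine lintegral_mono fun y => ?_
    by_cases hy : y ∈ Metric.ball x (2 * r)
    · rw [indicator_of_mem hy, indicator_of_mem hy]
      refine h.mono ?_
      rw [← mul_assoc]
      exact ENNReal.div_le_div_left (mul_le_mul_left ((hc₂ r hr).trans (by gcongr)) _) _
    · simp [hy, h.map_zero]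

theorem hlMax_div (g : EuclideanSpace ℝ (Fin n) → ℝ≥0∞) {l : ℝ≥0∞} (hl : l ≠ 0)
    (x : EuclideanSpace ℝ (Fin n)) : hlMax (fun y => g y / l) x = hlMax g x / l := by
  simp only [hlMax, div_eq_mul_inv, ENNReal.iSup_mul]
  refine iSup_congr fun r => iSup_congr fun hr => ?_
  rw [lintegral_mul_const' _ _ (by simpa using hl)]
  ring

/-- The local weak type estimate for the maximal function on `𝓜^{Φ,φ}`. -/
theorem exists_map_mul_volume_lt_hlMax_le_one (n : ℕ) (h : IsYoung Φ) (hφ : ClassG n Φ φ)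
    (hφd : AlmostDecreasing fun t => ENNReal.ofReal (φ t)) :
    ∃ K : ℝ≥0, 1 ≤ K ∧ ∀ N : ℝ≥0∞, N ≠ 0 → N ≠ ∞ → ∀ g : EuclideanSpace ℝ (Fin n) → ℝ≥0∞,
      AEMeasurable g → MorreyModular Φ φ N g → ∀ x r, 0 < r → ∀ c : ℝ≥0∞, c ≠ ∞ →
        Φ (c / (K * (morreyScale n Φ φ r * N))) *
          volume (Metric.ball x r ∩ {y | c < hlMax g y}) ≤ 1 := by
  obtain ⟨K, hK1, hK⟩ := exists_hlMax_le_max n h hφ hφd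
  -- The `2` comes from the level `2c` of the truncated inequality, the `4 ^ n` from the covering
  -- argument; convexity absorbs the latter into the argument of `Φ`.
  refine ⟨2 * 4 ^ n * K, ?_, fun N hN0 hNt g hgm hg x r hr c hc => ?_⟩
  · exact one_le_mul (one_le_mul (by norm_num) (one_le_pow₀ (by norm_num))) hK1
  obtain ⟨D, hD, hD1, hg1⟩ := hK N hN0 hNt g hg x r hr
  have hK0 : (K : ℝ≥0∞) ≠ 0 := by exact_mod_cast (one_pos.trans_le hK1).ne'
  have ha0 := morreyScale_ne_zero (n := n) h (hφ.pos r hr)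
  have hat := morreyScale_ne_top (n := n) (φ := φ) h hr
  set l := K * (morreyScale n Φ φ r * N) with hl
  have hl0 : l ≠ 0 := mul_ne_zero hK0 (mul_ne_zero ha0 hN0)
  have hlt : l ≠ ∞ := ENNReal.mul_ne_top (by simp) (ENNReal.mul_ne_top hat hNt)
  have h4 : (1 : ℝ≥0∞) ≤ 4 ^ n := one_le_pow₀ (by norm_num)
  have hL : ((2 * 4 ^ n * K : ℝ≥0) : ℝ≥0∞) * (morreyScale n Φ φ r * N) = 2 * 4 ^ n * l := by
    push_cast; ring
  have hdiv : c / (2 * 4 ^ n * l) = c / (2 * l) / 4 ^ n := by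
    rw [div_eq_mul_inv, div_eq_mul_inv, div_eq_mul_inv, mul_assoc c,
      ← ENNReal.mul_inv (Or.inr (by simp)) (Or.inr (by simp))]
    congr 2
    ring
  rw [hL]
  -- Below `D` the whole ball is affordable. At or above `D` the large radii cannot exceed the
  -- level, so only the local part counts.
  rcases lt_or_ge c D with hcD | hDc
  · refine le_trans ?_ hD1
    gcongr ?_ * ?_
    · refine h.mono ?_
      gcongr ?_ / ?_
      have : (1 : ℝ≥0∞) ≤ 2 * 4 ^ n := one_le_mul (by norm_num) h4
      exact le_mul_of_one_le_left' this
    · exact measure_mono inter_subset_left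
  · set g₁ := (Metric.ball x (2 * r)).indicator g with hg₁
    have hsub : Metric.ball x r ∩ {y | c < hlMax g y} ⊆
        {y | 2 * (c / (2 * l)) < hlMax (fun z => g₁ z / l) y} := by
      rintro y ⟨hy, hcy⟩
      have h1 : c < hlMax g₁ y := by
        rcases lt_max_iff.1 (lt_of_lt_of_le hcy (hD y hy)) with h1 | h1
        · exact h1
        · exact absurd h1 hDc.not_gt
      have h2 : 2 * (c / (2 * l)) = c / l := by
        rw [← mul_div_assoc, ENNReal.mul_div_mul_left _ _ (by simp) (by simp)]
      rw [mem_ofPred_eq, h2, hlMax_div _ hl0]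
      exact ENNReal.div_lt_div_right hl0 hlt h1
    have hgm1 : AEMeasurable fun z => g₁ z / l := (hgm.indicator measurableSet_ball).div_const l
    have hfin : c / (2 * l) ≠ ∞ := ENNReal.div_ne_top hc (mul_ne_zero (by simp) hl0)
    have h5 := (h.map_mul_volume_lt_hlMax_le hgm1 hfin).trans
      (mul_le_mul_right hg1 _)
    rw [hdiv]
    refine (ENNReal.mul_le_mul_iff_right (a := 4 ^ n) (by simp) (by simp)).1 (le_trans ?_ h5)
    rw [← mul_assoc]
    gcongr ?_ * ?_
    · exact h.le_mul_div h4 (by simp) _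
    · exact measure_mono hsub

/-- The local strong type estimate for the maximal function on `𝓜^{Φ,φ}` when `Φ ∈ ∇₂`. -/
theorem exists_setLIntegral_map_hlMax_le_one (n : ℕ) (h : IsYoung Φ) (hΦ : Nabla2 Φ)
    (hφ : ClassG n Φ φ) (hφd : AlmostDecreasing fun t => ENNReal.ofReal (φ t)) :
    ∃ K : ℝ≥0, 1 ≤ K ∧ ∀ N : ℝ≥0∞, N ≠ 0 → N ≠ ∞ → ∀ g : EuclideanSpace ℝ (Fin n) → ℝ≥0∞,
      AEMeasurable g → MorreyModular Φ φ N g →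
        MorreyModular Φ φ (K * N) (hlMax g) := by
  obtain ⟨K, hK1, hK⟩ := exists_hlMax_le_max n h hφ hφd
  obtain ⟨b, hb1, hb⟩ := h.exists_lintegral_map_hlMax_le n hΦ
  have h44 : (1 : ℝ≥0) ≤ 4 * 4 ^ n := one_le_mul (by norm_num) (one_le_pow₀ (by norm_num))
  refine ⟨4 * 4 ^ n * b * K, one_le_mul (one_le_mul h44 hb1) hK1,
    fun N hN0 hNt g hgm hg x r hr => ?_⟩
  obtain ⟨D, hD, hD1, hg1⟩ := hK N hN0 hNt g hg x r hr
  have hK0 : (K : ℝ≥0∞) ≠ 0 := by exact_mod_cast (one_pos.trans_le hK1).ne'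
  have hb0 : (b : ℝ≥0∞) ≠ 0 := by exact_mod_cast (one_pos.trans_le hb1).ne'
  have ha0 := morreyScale_ne_zero (n := n) h (hφ.pos r hr)
  have hat := morreyScale_ne_top (n := n) (φ := φ) h hr
  set l := K * (morreyScale n Φ φ r * N) with hl
  have hl0 : l ≠ 0 := mul_ne_zero hK0 (mul_ne_zero ha0 hN0)
  have hlt : l ≠ ∞ := ENNReal.mul_ne_top (by simp) (ENNReal.mul_ne_top hat hNt)
  -- With this choice `A⁻¹ · 2 · 4 ^ n = 1/2`, leaving the other half for the contribution of `D`.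
  set A : ℝ≥0∞ := 4 * 4 ^ n with hA
  have hA1 : 1 ≤ A := one_le_mul (by norm_num) (one_le_pow₀ (by norm_num))
  have hAt : A ≠ ∞ := ENNReal.mul_ne_top (by simp) (by simp)
  have hA0 : A ≠ 0 := (one_pos.trans_le hA1).ne'
  have hL : morreyScale n Φ φ r * (((4 * 4 ^ n * b * K : ℝ≥0) : ℝ≥0∞) * N) = l * b * A := by
    push_cast; ring
  have hinv : ∀ t : ℝ≥0∞, t / (l * b * A) = t / l / b / A := fun t => by
    simp only [div_eq_mul_inv]
    rw [ENNReal.mul_inv (Or.inr hAt) (Or.inr hA0), ENNReal.mul_inv (Or.inl hl0) (Or.inl hlt)]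
    ring
  set g₁ := (Metric.ball x (2 * r)).indicator g with hg₁
  have hgm1 : AEMeasurable fun z => g₁ z / l := (hgm.indicator measurableSet_ball).div_const l
  have hpt : ∀ y ∈ Metric.ball x r, Φ (hlMax g y / (l * b * A)) ≤
      A⁻¹ * Φ (hlMax (fun z => g₁ z / l) y / b) + 2⁻¹ * Φ (D / l) := by
    intro y hy
    rcases le_max_iff.1 (hD y hy) with h1 | h1
    · refine le_add_right ?_
      rw [hlMax_div _ hl0, hinv, div_eq_mul_inv _ A, mul_comm _ A⁻¹]
      refine (h.map_mul_le (by simpa using hA1) _).trans ?_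
      gcongr
      exact h.mono (by gcongr)
    · refine le_add_left ?_
      refine le_trans (h.mono ?_) (h.map_mul_le (by simp) _)
      calc hlMax g y / (l * b * A) ≤ D / (l * 1 * 2) := by
            gcongr
            · exact_mod_cast hb1
            · calc (2 : ℝ≥0∞) ≤ 4 * 1 := by norm_num
                _ ≤ A := by rw [hA]; gcongr; exact one_le_pow₀ (by norm_num)
        _ = 2⁻¹ * (D / l) := by
            rw [mul_one, div_eq_mul_inv, div_eq_mul_inv,
              ENNReal.mul_inv (Or.inr (by simp)) (Or.inr (by simp))]
            ring
  rw [hL]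
  calc ∫⁻ y in Metric.ball x r, Φ (hlMax g y / (l * b * A))
      ≤ ∫⁻ y in Metric.ball x r,
          (A⁻¹ * Φ (hlMax (fun z => g₁ z / l) y / b) + 2⁻¹ * Φ (D / l)) :=
        setLIntegral_mono' measurableSet_ball hpt
    _ = A⁻¹ * (∫⁻ y in Metric.ball x r, Φ (hlMax (fun z => g₁ z / l) y / b)) +
          2⁻¹ * (Φ (D / l) * volume (Metric.ball x r)) := by
        rw [lintegral_add_right _ measurable_const, setLIntegral_const,
          lintegral_const_mul' _ _ (by simpa using hA0), mul_assoc]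
    _ ≤ A⁻¹ * (2 * 4 ^ n * 1) + 2⁻¹ * 1 := by
        gcongr
        calc _ ≤ ∫⁻ y, Φ (hlMax (fun z => g₁ z / l) y / b) := setLIntegral_le_lintegral _ _
          _ ≤ _ := hb _ hgm1
          _ ≤ _ := by gcongr
    _ = 1 := by
        have h2 : (2 * 4 ^ n * 1 : ℝ≥0∞) = A * 2⁻¹ := by
          rw [hA, show (4 : ℝ≥0∞) * 4 ^ n = 2 * 4 ^ n * 2 by ring, mul_assoc _ 2,
            ENNReal.mul_inv_cancel (by simp) (by simp)]
        rw [h2, ← mul_assoc, ENNReal.inv_mul_cancel hA0 hAt, one_mul, mul_one,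
          ENNReal.inv_two_add_inv_two]

end Local

/-! ### The change of Young function `Ψ(t) = Φ(t^(1/β))`. -/

section Power

variable {Φ Ψ : ℝ≥0∞ → ℝ≥0∞} {β : ℝ}

theorem IsYoung.comp_rpow (h : IsYoung Φ) (hβ0 : 0 < β) (hβ1 : β ≤ 1)
    (hΨ : ∀ t, Ψ t = Φ (t ^ (1 / β))) : IsYoung Ψ := by
  have hp0 : 0 < 1 / β := by positivity
  have hp1 : 1 ≤ 1 / β := by rwa [le_div_iff₀ hβ0, one_mul]
  obtain rfl : Ψ = fun t => Φ (t ^ (1 / β)) := funext hΨ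
  have hcont : Continuous fun t : ℝ≥0∞ => t ^ (1 / β) := ENNReal.continuous_rpow_const
  have hz : (0 : ℝ≥0∞) ^ (1 / β) = 0 := ENNReal.zero_rpow_of_pos hp0
  have ht : (∞ : ℝ≥0∞) ^ (1 / β) = ∞ := ENNReal.top_rpow_of_pos hp0
  refine ⟨⟨convex_univ, fun x _ y _ a b _ _ hab => ?_⟩, fun r => ?_, ?_, ?_, ?_, ?_⟩
  · refine (h.mono (ENNReal.rpow_arith_mean_le_arith_mean2_rpow a b x y ?_ hp1)).trans ?_
    · exact_mod_cast hab
    · exact h.convex.2 (mem_univ _) (mem_univ _) (zero_le (a := a)) (zero_le (a := b)) hab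
  · exact (h.left_continuous _).comp hcont.continuousWithinAt fun t ht =>
      ENNReal.rpow_le_rpow ht hp0.le
  · rw [hz, h.map_zero]
  · refine h.tendsto_zero.comp (tendsto_nhdsWithin_iff.2 ⟨?_, ?_⟩)
    · have := (hcont.tendsto 0).mono_left (nhdsWithin_le_nhds (s := Ioi 0))
      rwa [hz] at this
    · filter_upwards [self_mem_nhdsWithin] with t ht
      exact ENNReal.rpow_pos_of_nonneg ht hp0.le
  · rw [ht, h.map_top]
  · refine h.tendsto_top.comp (tendsto_nhdsWithin_iff.2 ⟨?_, ?_⟩)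
    · have := (hcont.tendsto ∞).mono_left (nhdsWithin_le_nhds (s := Iio ∞))
      rwa [ht] at this
    · filter_upwards [self_mem_nhdsWithin] with t ht
      exact ENNReal.rpow_lt_top_of_nonneg hp0.le ht.ne

/-- The map `t ↦ t^β` is an order isomorphism of `[0,∞]`, so it commutes with infima. -/
theorem youngInv_comp_rpow (hβ0 : 0 < β) (hΨ : ∀ t, Ψ t = Φ (t ^ (1 / β))) (s : ℝ≥0∞) :
    youngInv Ψ s = youngInv Φ s ^ β := by
  rw [youngInv, youngInv, ← ENNReal.orderIsoRpow_apply β hβ0,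
    OrderIso.map_sInf_eq_sInf_symm_preimage, ENNReal.orderIsoRpow_symm_apply]
  simp only [hΨ]
  rfl

theorem morreyScale_comp_rpow {n : ℕ} {φ η : ℝ → ℝ} (hβ0 : 0 < β)
    (hΨ : ∀ t, Ψ t = Φ (t ^ (1 / β))) (hη : ∀ t, 0 < t → η t = φ t ^ β)
    (hφ : ∀ t, 0 < t → 0 < φ t) {r : ℝ} (hr : 0 < r) :
    morreyScale n Ψ η r = morreyScale n Φ φ r ^ β := by
  rw [morreyScale, morreyScale, invAt, youngInv_comp_rpow hβ0 hΨ, hη r hr,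
    ← ENNReal.ofReal_rpow_of_pos (hφ r hr), ENNReal.div_rpow_of_nonneg _ _ hβ0.le]
  rfl

end Power

/-! ### Passage between norms and modular bounds. -/

section Norms

variable {n : ℕ} {Φ : ℝ≥0∞ → ℝ≥0∞} {φ : ℝ → ℝ}
  {F : Type*} [TopologicalSpace F] [ESeminormedAddMonoid F]

theorem IsYoung.lintegral_indicator_div (h : IsYoung Φ) (f : EuclideanSpace ℝ (Fin n) → F)
    {s : Set (EuclideanSpace ℝ (Fin n))} (hs : MeasurableSet s) (l : ℝ≥0∞) :
    ∫⁻ x, Φ (‖s.indicator f x‖ₑ / l) = ∫⁻ x in s, Φ (‖f x‖ₑ / l) := by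
  rw [← lintegral_indicator hs]
  refine lintegral_congr fun x => ?_
  by_cases hx : x ∈ s <;> simp [hx, h.map_zero]

theorem orliczNorm_le (Φ : ℝ≥0∞ → ℝ≥0∞) {f : EuclideanSpace ℝ (Fin n) → F} {l : ℝ≥0∞}
    (hl0 : l ≠ 0) (hlt : l ≠ ∞) (hl : ∫⁻ x, Φ (‖f x‖ₑ / l) ≤ 1) : orliczNorm Φ f ≤ l :=
  sInf_le ⟨pos_iff_ne_zero.2 hl0, hlt.lt_top, hl⟩

theorem IsYoung.orliczNorm_mono (h : IsYoung Φ) {F' : Type*} [TopologicalSpace F']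
    [ESeminormedAddMonoid F'] {f : EuclideanSpace ℝ (Fin n) → F}
    {g : EuclideanSpace ℝ (Fin n) → F'} (hfg : ∀ x, ‖f x‖ₑ ≤ ‖g x‖ₑ) :
    orliczNorm Φ f ≤ orliczNorm Φ g := by
  refine sInf_le_sInf fun l ⟨hl0, hlt, hl⟩ => ⟨hl0, hlt, le_trans ?_ hl⟩
  exact lintegral_mono fun x => h.mono (ENNReal.div_le_div_right (hfg x) _)

theorem IsYoung.weakOrliczNorm_le_orliczNorm (h : IsYoung Φ) (f : EuclideanSpace ℝ (Fin n) → F) :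
    weakOrliczNorm Φ f ≤ orliczNorm Φ f := by
  refine iSup₂_le fun l hl => h.orliczNorm_mono fun x => ?_
  by_cases hx : (l : ℝ≥0∞) < ‖f x‖ₑ
  · rw [indicator_of_mem (by exact hx)]
    exact hx.le
  · rw [indicator_of_notMem (by exact hx)]
    simp

theorem weakMorreyNorm_le_morreyNorm (h : IsYoung Φ) (f : EuclideanSpace ℝ (Fin n) → F) :
    weakMorreyNorm Φ φ f ≤ morreyNorm Φ φ f := by
  refine iSup_mono fun x => iSup_mono fun r => iSup_mono fun hr => ?_
  gcongr
  exact h.weakOrliczNorm_le_orliczNorm _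

theorem inv_mul_invAt_eq (h : IsYoung Φ) {r : ℝ} (hr : 0 < r) :
    (ENNReal.ofReal (φ r))⁻¹ * invAt n Φ r = (morreyScale n Φ φ r)⁻¹ := by
  rw [morreyScale, ENNReal.inv_div (Or.inl (h.invAt_lt_top n r).ne)
    (Or.inl (h.invAt_pos n hr).ne'), div_eq_mul_inv, mul_comm]

theorem morreyNorm_le_iff (h : IsYoung Φ) (hφ : ∀ r, 0 < r → 0 < φ r)
    {f : EuclideanSpace ℝ (Fin n) → F} {N : ℝ≥0∞} :
    morreyNorm Φ φ f ≤ N ↔ ∀ x r, 0 < r →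
      orliczNorm Φ ((Metric.ball x r).indicator f) ≤ morreyScale n Φ φ r * N := by
  simp only [morreyNorm, iSup_le_iff]
  refine forall_congr' fun x => forall_congr' fun r => forall_congr' fun hr => ?_
  rw [inv_mul_invAt_eq h hr, mul_comm, ← div_eq_mul_inv,
    ENNReal.div_le_iff (morreyScale_ne_zero h (hφ r hr)) (morreyScale_ne_top h hr), mul_comm N]

theorem weakMorreyNorm_le_iff (h : IsYoung Φ) (hφ : ∀ r, 0 < r → 0 < φ r)
    {f : EuclideanSpace ℝ (Fin n) → F} {N : ℝ≥0∞} :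
    weakMorreyNorm Φ φ f ≤ N ↔ ∀ x r, 0 < r →
      weakOrliczNorm Φ ((Metric.ball x r).indicator f) ≤ morreyScale n Φ φ r * N := by
  simp only [weakMorreyNorm, iSup_le_iff]
  refine forall_congr' fun x => forall_congr' fun r => forall_congr' fun hr => ?_
  rw [inv_mul_invAt_eq h hr, mul_comm, ← div_eq_mul_inv,
    ENNReal.div_le_iff (morreyScale_ne_zero h (hφ r hr)) (morreyScale_ne_top h hr), mul_comm N]

/-- Strictness provides, on each ball, an admissible Luxemburg constant below the scaled `N`,
whether or not the infimum is attained. -/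
theorem morreyModular_of_morreyNorm_lt (h : IsYoung Φ) (hφ : ∀ r, 0 < r → 0 < φ r)
    {f : EuclideanSpace ℝ (Fin n) → F} {N : ℝ≥0∞} (hN : morreyNorm Φ φ f < N) :
    MorreyModular Φ φ N fun x => ‖f x‖ₑ := by
  intro x r hr
  have h1 := (morreyNorm_le_iff h hφ (f := f)).1 le_rfl x r hr
  have h2 : morreyScale n Φ φ r * morreyNorm Φ φ f < morreyScale n Φ φ r * N :=
    (ENNReal.mul_lt_mul_iff_right (morreyScale_ne_zero h (hφ r hr)) (morreyScale_ne_top h hr)).2 hN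
  obtain ⟨l, ⟨hl0, hlt, hl⟩, hlN⟩ := sInf_lt_iff.1 (h1.trans_lt h2)
  rw [h.lintegral_indicator_div f measurableSet_ball] at hl
  refine le_trans (lintegral_mono fun y => h.mono ?_) hl
  exact ENNReal.div_le_div_left hlN.le _

theorem morreyNorm_le_of_morreyModular (h : IsYoung Φ) (hφ : ∀ r, 0 < r → 0 < φ r)
    {f : EuclideanSpace ℝ (Fin n) → F} {N : ℝ≥0∞} (hN0 : N ≠ 0) (hNt : N ≠ ∞)
    (hf : MorreyModular Φ φ N fun x => ‖f x‖ₑ) : morreyNorm Φ φ f ≤ N := by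
  rw [morreyNorm_le_iff h hφ]
  intro x r hr
  refine orliczNorm_le Φ (mul_ne_zero (morreyScale_ne_zero h (hφ r hr)) hN0)
    (ENNReal.mul_ne_top (morreyScale_ne_top h hr) hNt) ?_
  rw [h.lintegral_indicator_div f measurableSet_ball]
  exact hf x r hr

theorem weakMorreyNorm_le_of_forall (h : IsYoung Φ) (hφ : ∀ r, 0 < r → 0 < φ r)
    {f : EuclideanSpace ℝ (Fin n) → ℝ≥0∞} (hf : Measurable f) {N : ℝ≥0∞} (hN0 : N ≠ 0)
    (hNt : N ≠ ∞) (hfN : ∀ x r, 0 < r → ∀ c : ℝ≥0∞, c ≠ ∞ →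
      Φ (c / (morreyScale n Φ φ r * N)) * volume (Metric.ball x r ∩ {y | c < f y}) ≤ 1) :
    weakMorreyNorm Φ φ f ≤ N := by
  rw [weakMorreyNorm_le_iff h hφ]
  intro x r hr
  refine iSup₂_le fun c hc => ?_
  refine orliczNorm_le Φ (mul_ne_zero (morreyScale_ne_zero h (hφ r hr)) hN0)
    (ENNReal.mul_ne_top (morreyScale_ne_top h hr) hNt) ?_
  have hset : {y | (c : ℝ≥0∞) < ‖(Metric.ball x r).indicator f y‖ₑ} =
      Metric.ball x r ∩ {y | (c : ℝ≥0∞) < f y} := by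
    ext y
    by_cases hy : y ∈ Metric.ball x r
    · simp only [mem_ofPred_eq, mem_inter_iff, hy, indicator_of_mem, true_and, enorm_eq_self]
    · simp [hy]
  have hms : MeasurableSet (Metric.ball x r ∩ {y | (c : ℝ≥0∞) < f y}) :=
    measurableSet_ball.inter (measurableSet_lt measurable_const hf)
  rw [hset, h.lintegral_indicator_div _ hms]
  simpa using hfN x r hr c (by simp)

/-- Local integrability is automatic: the average bound `setLIntegral_ball_le` applies to any
admissible constant `l`. -/
theorem IsYoung.memOrlicz_indicator_ball (h : IsYoung Φ) {f : EuclideanSpace ℝ (Fin n) → F}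
    (hf : AEStronglyMeasurable f) {x : EuclideanSpace ℝ (Fin n)} {r : ℝ} (hr : 0 < r)
    (hn : orliczNorm Φ ((Metric.ball x r).indicator f) < ∞) :
    MemOrlicz Φ ((Metric.ball x r).indicator f) := by
  obtain ⟨l, ⟨hl0, hlt, hl⟩, -⟩ := sInf_lt_iff.1 hn
  constructor
  · refine Integrable.locallyIntegrable ⟨hf.indicator measurableSet_ball, ?_⟩
    rw [hasFiniteIntegral_iff_enorm]
    simp only [enorm_indicator_eq_indicator_enorm]
    rw [lintegral_indicator measurableSet_ball]
    rw [h.lintegral_indicator_div f measurableSet_ball] at hl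
    refine (h.setLIntegral_ball_le hr hl0.ne' hlt.ne hl).trans_lt ?_
    have hV : (volume (Metric.ball x r))⁻¹ < ∞ :=
      ENNReal.inv_lt_top.2 (pos_iff_ne_zero.2 (volume_ball_ne_zero x hr))
    exact ENNReal.mul_lt_top (ENNReal.mul_lt_top (ENNReal.mul_lt_top (by simp)
      (h.youngInv_lt_top hV)) hlt) (volume_ball_ne_top x r).lt_top
  · refine ⟨l⁻¹.toNNReal, ENNReal.toNNReal_pos (ENNReal.inv_ne_zero.2 hlt.ne)
      (ENNReal.inv_ne_top.2 hl0.ne'), ?_⟩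
    rw [ENNReal.coe_toNNReal (ENNReal.inv_ne_top.2 hl0.ne')]
    simp only [mul_comm l⁻¹, ← div_eq_mul_inv]
    exact hl.trans_lt ENNReal.one_lt_top

theorem IsYoung.memMorrey (h : IsYoung Φ) (hφ : ∀ r, 0 < r → 0 < φ r)
    {f : EuclideanSpace ℝ (Fin n) → F} (hf : AEStronglyMeasurable f)
    (hN : morreyNorm Φ φ f < ∞) : MemMorrey Φ φ f := by
  refine ⟨hf, fun x r hr => h.memOrlicz_indicator_ball hf hr ?_, hN⟩
  exact ((morreyNorm_le_iff h hφ).1 le_rfl x r hr).trans_lt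
    (ENNReal.mul_lt_top (morreyScale_ne_top h hr).lt_top hN)

theorem IsYoung.memWeakMorrey (h : IsYoung Φ) (hφ : ∀ r, 0 < r → 0 < φ r)
    {f : EuclideanSpace ℝ (Fin n) → F} (hf : AEStronglyMeasurable f)
    (hN : weakMorreyNorm Φ φ f < ∞) : MemWeakMorrey Φ φ f := by
  refine ⟨hf, fun x r hr => ⟨hf.indicator measurableSet_ball, ?_⟩, hN⟩
  exact ((weakMorreyNorm_le_iff h hφ).1 le_rfl x r hr).trans_lt
    (ENNReal.mul_lt_top (morreyScale_ne_top h hr).lt_top hN)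

theorem measurable_fracMax (ρ : ℝ → ℝ) (f : EuclideanSpace ℝ (Fin n) → F) :
    Measurable (fracMax ρ f) :=
  (lowerSemicontinuous_iSup_ball (fun r => ENNReal.ofReal (ρ r)) fun y => ‖f y‖ₑ).measurable

end Norms

/-! ### Condition (∗) implies boundedness. -/

section Sufficiency

variable {n : ℕ} {Φ Ψ : ℝ≥0∞ → ℝ≥0∞} {φ η ρ : ℝ → ℝ} {β : ℝ}
  {F : Type*} [TopologicalSpace F] [ESeminormedAddMonoid F]

/-- The Hedberg-type pointwise bound. -/
theorem exists_fracMax_le (n : ℕ) (h : IsYoung Φ) (hφ : ClassG n Φ φ) (hβ0 : 0 < β) (hβ1 : β < 1)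
    {C : ℝ} (hC : 0 < C) (hρ : ∀ t, 0 < t → ρ t ≤ C * φ t ^ (β - 1)) :
    ∃ H : ℝ≥0, H ≠ 0 ∧ ∀ N : ℝ≥0∞, N ≠ 0 → N ≠ ∞ → ∀ f : EuclideanSpace ℝ (Fin n) → F,
      MorreyModular Φ φ N (fun y => ‖f y‖ₑ) → ∀ x,
        fracMax ρ f x ≤ H * (hlMax (fun y => ‖f y‖ₑ) x ^ β * N ^ (1 - β)) := by
  obtain ⟨c, hc⟩ := exists_setLIntegral_div_volume_le n h hφ
  have hγ : 0 ≤ 1 - β := by linarith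
  set H : ℝ≥0∞ := max 1 (ENNReal.ofReal C * (c : ℝ≥0∞) ^ (1 - β)) with hH
  have hHt : H ≠ ∞ := by
    simp only [hH, ne_eq, max_eq_top, ENNReal.one_ne_top, false_or]
    exact ENNReal.mul_ne_top ENNReal.ofReal_ne_top (ENNReal.rpow_ne_top_of_nonneg hγ (by simp))
  have hH0 : H ≠ 0 := (one_pos.trans_le (le_max_left _ _)).ne'
  refine ⟨H.toNNReal, by simp [ENNReal.toNNReal_eq_zero_iff, hHt, hH0],
    fun N hN0 hNt f hf x => ?_⟩
  rw [ENNReal.coe_toNNReal hHt]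
  refine iSup₂_le fun r hr => ?_
  set M := hlMax (fun y => ‖f y‖ₑ) x with hM
  set A := (∫⁻ y in Metric.ball x r, ‖f y‖ₑ) / volume (Metric.ball x r) with hA
  have hA1 : A ≤ M := le_hlMax (fun y => ‖f y‖ₑ) x hr
  have hA2 : A ≤ c * (ENNReal.ofReal (φ r) * N) := hc N hN0 hNt _ hf x r hr
  have hφr : 0 < φ r := hφ.pos r hr
  have hρr : ENNReal.ofReal (ρ r) ≤ ENNReal.ofReal C * ENNReal.ofReal (φ r) ^ (β - 1) := by
    rw [ENNReal.ofReal_rpow_of_pos hφr, ← ENNReal.ofReal_mul hC.le]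
    exact ENNReal.ofReal_le_ofReal (hρ r hr)
  have hφ1 : ENNReal.ofReal (φ r) ^ (β - 1) * ENNReal.ofReal (φ r) ^ (1 - β) = 1 := by
    rw [← ENNReal.rpow_add _ _ (by simpa using hφr) ENNReal.ofReal_ne_top]
    simp
  -- The factor `A^β` is bounded by the maximal function and `A^(1-β)` by `φ(r) N`; the powers of
  -- `φ(r)` then cancel against (∗).
  calc ENNReal.ofReal (ρ r) / volume (Metric.ball x r) * ∫⁻ y in Metric.ball x r, ‖f y‖ₑ
      = ENNReal.ofReal (ρ r) * A := by
        rw [hA, div_eq_mul_inv, div_eq_mul_inv]; ring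
    _ = ENNReal.ofReal (ρ r) * (A ^ β * A ^ (1 - β)) := by
        rw [← ENNReal.rpow_add_of_nonneg _ _ hβ0.le hγ]; simp
    _ ≤ (ENNReal.ofReal C * ENNReal.ofReal (φ r) ^ (β - 1)) *
          (M ^ β * (c * (ENNReal.ofReal (φ r) * N)) ^ (1 - β)) := by
        gcongr
    _ = ENNReal.ofReal C * (c : ℝ≥0∞) ^ (1 - β) *
          (ENNReal.ofReal (φ r) ^ (β - 1) * ENNReal.ofReal (φ r) ^ (1 - β)) *
          (M ^ β * N ^ (1 - β)) := by
        rw [ENNReal.mul_rpow_of_nonneg _ _ hγ, ENNReal.mul_rpow_of_nonneg _ _ hγ]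
        ring
    _ ≤ H * (M ^ β * N ^ (1 - β)) := by
        rw [hφ1, mul_one]
        gcongr
        exact le_max_right _ _

theorem rpow_scale_eq (hβ0 : 0 < β) (hβ1 : β < 1) (H K a N : ℝ≥0∞) :
    a ^ β * (H * K ^ β * N) = H * ((K * (a * N)) ^ β * N ^ (1 - β)) := by
  have hN : N = N ^ β * N ^ (1 - β) := by
    rw [← ENNReal.rpow_add_of_nonneg _ _ hβ0.le (by linarith)]; simp
  rw [ENNReal.mul_rpow_of_nonneg _ _ hβ0.le, ENNReal.mul_rpow_of_nonneg _ _ hβ0.le]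
  conv_lhs => rw [hN]
  ring

/-- Transfers the pointwise Hedberg bound to arguments of `Φ`: the constant `H K^β` in the target
scale corresponds to `K` in the source scale. -/
theorem rpow_div_scale_le {H K a N : ℝ≥0∞} (hβ0 : 0 < β) (hβ1 : β < 1) (hH0 : H ≠ 0) (hHt : H ≠ ∞)
    (hN0 : N ≠ 0) (hNt : N ≠ ∞) {s t : ℝ≥0∞} (hst : s ≤ H * (t ^ β * N ^ (1 - β))) :
    (s / (a ^ β * (H * K ^ β * N))) ^ (1 / β) ≤ t / (K * (a * N)) := by
  have hQ0 : N ^ (1 - β) ≠ 0 := (ENNReal.rpow_pos (pos_iff_ne_zero.2 hN0) hNt).ne'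
  have hQt : N ^ (1 - β) ≠ ∞ := ENNReal.rpow_ne_top_of_nonneg (by linarith) hNt
  rw [one_div, ENNReal.rpow_inv_le_iff hβ0, rpow_scale_eq hβ0 hβ1,
    ENNReal.div_rpow_of_nonneg _ _ hβ0.le]
  refine (ENNReal.div_le_div_right hst _).trans_eq ?_
  rw [ENNReal.mul_div_mul_left _ _ hH0 hHt, ENNReal.mul_div_mul_right _ _ hQ0 hQt]

theorem exists_weakMorreyNorm_fracMax_le (h : IsYoung Φ) (hφ : ClassG n Φ φ)
    (hφd : AlmostDecreasing fun t => ENNReal.ofReal (φ t)) (hβ0 : 0 < β) (hβ1 : β < 1)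
    (hη : ∀ t, 0 < t → η t = φ t ^ β) (hΨ : ∀ t, Ψ t = Φ (t ^ (1 / β)))
    {C : ℝ} (hC : 0 < C) (hρ : ∀ t, 0 < t → ρ t ≤ C * φ t ^ (β - 1)) :
    ∃ K : ℝ≥0, K ≠ 0 ∧ ∀ N : ℝ≥0∞, N ≠ 0 → N ≠ ∞ → ∀ f : EuclideanSpace ℝ (Fin n) → F,
      AEMeasurable (fun y => ‖f y‖ₑ) → MorreyModular Φ φ N (fun y => ‖f y‖ₑ) →
        weakMorreyNorm Ψ η (fracMax ρ f) ≤ K * N := by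
  obtain ⟨H, hH0, hH⟩ := exists_fracMax_le (F := F) n h hφ hβ0 hβ1 hC hρ
  obtain ⟨K, hK1, hK⟩ := exists_map_mul_volume_lt_hlMax_le_one n h hφ hφd
  have hK0 : K ≠ 0 := (one_pos.trans_le hK1).ne'
  have hη0 : ∀ t, 0 < t → 0 < η t := fun t ht => by
    rw [hη t ht]; exact Real.rpow_pos_of_pos (hφ.pos t ht) β
  have hHK : ((H * K ^ β : ℝ≥0) : ℝ≥0∞) = H * (K : ℝ≥0∞) ^ β := by
    rw [ENNReal.coe_mul, ENNReal.coe_rpow_of_nonneg _ hβ0.le]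
  have hHK0 : H * K ^ β ≠ 0 := mul_ne_zero hH0 (NNReal.rpow_pos (pos_iff_ne_zero.2 hK0)).ne'
  refine ⟨H * K ^ β, hHK0, fun N hN0 hNt f hfm hf => ?_⟩
  refine weakMorreyNorm_le_of_forall (h.comp_rpow hβ0 hβ1.le hΨ) hη0 (measurable_fracMax ρ f)
    (mul_ne_zero (by simpa using hHK0) hN0) (ENNReal.mul_ne_top ENNReal.coe_ne_top hNt)
    fun x r hr c hc => ?_
  have hQ0 : N ^ (1 - β) ≠ 0 := (ENNReal.rpow_pos (pos_iff_ne_zero.2 hN0) hNt).ne'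
  have hQt : N ^ (1 - β) ≠ ∞ := ENNReal.rpow_ne_top_of_nonneg (by linarith) hNt
  have hH0' : (H : ℝ≥0∞) ≠ 0 := by simpa using hH0
  -- `d` solves `H d^β N^(1-β) = c`, so `M_ρ f > c` forces `Mf > d`.
  set d : ℝ≥0∞ := (c / H / N ^ (1 - β)) ^ (1 / β) with hd
  have hdt : d ≠ ∞ := ENNReal.rpow_ne_top_of_nonneg (by positivity)
    (ENNReal.div_ne_top (ENNReal.div_ne_top hc hH0') hQ0)
  have hdc : H * (d ^ β * N ^ (1 - β)) = c := by
    rw [hd, ← ENNReal.rpow_mul, one_div, inv_mul_cancel₀ hβ0.ne', ENNReal.rpow_one,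
      ENNReal.div_mul_cancel hQ0 hQt, ENNReal.mul_div_cancel hH0' (by simp)]
  refine le_trans ?_ (hK N hN0 hNt _ hfm hf x r hr d hdt)
  gcongr ?_ * ?_
  · rw [hΨ, morreyScale_comp_rpow hβ0 hΨ hη hφ.pos hr, hHK]
    exact h.mono (rpow_div_scale_le hβ0 hβ1 hH0' (by simp) hN0 hNt hdc.ge)
  · refine measure_mono (inter_subset_inter_right _ fun y hy => ?_)
    have h1 : H * (d ^ β * N ^ (1 - β)) < H * (hlMax (fun y => ‖f y‖ₑ) y ^ β * N ^ (1 - β)) := by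
      rw [hdc]
      exact lt_of_lt_of_le hy (hH N hN0 hNt f hf y)
    by_contra hle
    have hle' : hlMax (fun y => ‖f y‖ₑ) y ≤ d := not_lt.1 hle
    exact absurd h1 (not_lt.2 (by gcongr))

theorem exists_morreyNorm_fracMax_le (h : IsYoung Φ) (hΦ : Nabla2 Φ) (hφ : ClassG n Φ φ)
    (hφd : AlmostDecreasing fun t => ENNReal.ofReal (φ t)) (hβ0 : 0 < β) (hβ1 : β < 1)
    (hη : ∀ t, 0 < t → η t = φ t ^ β) (hΨ : ∀ t, Ψ t = Φ (t ^ (1 / β)))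
    {C : ℝ} (hC : 0 < C) (hρ : ∀ t, 0 < t → ρ t ≤ C * φ t ^ (β - 1)) :
    ∃ K : ℝ≥0, K ≠ 0 ∧ ∀ N : ℝ≥0∞, N ≠ 0 → N ≠ ∞ → ∀ f : EuclideanSpace ℝ (Fin n) → F,
      AEMeasurable (fun y => ‖f y‖ₑ) → MorreyModular Φ φ N (fun y => ‖f y‖ₑ) →
        morreyNorm Ψ η (fracMax ρ f) ≤ K * N := by
  obtain ⟨H, hH0, hH⟩ := exists_fracMax_le (F := F) n h hφ hβ0 hβ1 hC hρ
  obtain ⟨K, hK1, hK⟩ := exists_setLIntegral_map_hlMax_le_one n h hΦ hφ hφd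
  have hK0 : K ≠ 0 := (one_pos.trans_le hK1).ne'
  have hη0 : ∀ t, 0 < t → 0 < η t := fun t ht => by
    rw [hη t ht]; exact Real.rpow_pos_of_pos (hφ.pos t ht) β
  have hHK : ((H * K ^ β : ℝ≥0) : ℝ≥0∞) = H * (K : ℝ≥0∞) ^ β := by
    rw [ENNReal.coe_mul, ENNReal.coe_rpow_of_nonneg _ hβ0.le]
  have hHK0 : H * K ^ β ≠ 0 := mul_ne_zero hH0 (NNReal.rpow_pos (pos_iff_ne_zero.2 hK0)).ne'
  refine ⟨H * K ^ β, hHK0, fun N hN0 hNt f hfm hf => ?_⟩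
  refine morreyNorm_le_of_morreyModular (h.comp_rpow hβ0 hβ1.le hΨ) hη0
    (mul_ne_zero (by simpa using hHK0) hN0) (ENNReal.mul_ne_top ENNReal.coe_ne_top hNt)
    fun x r hr => ?_
  have hM := hK N hN0 hNt _ hfm hf x r hr
  rw [mul_left_comm] at hM
  refine le_trans (lintegral_mono fun y => ?_) hM
  rw [hΨ, morreyScale_comp_rpow hβ0 hΨ hη hφ.pos hr, hHK]
  exact h.mono (rpow_div_scale_le hβ0 hβ1 (by simpa using hH0) (by simp) hN0 hNt
    (hH N hN0 hNt f hf y))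

/-- Modular bounds are available only for finite nonzero `N'` above the norm; letting `N'` decrease
to the norm also covers norm `0`. -/
theorem le_mul_of_forall_gt {K : ℝ≥0} (hK : K ≠ 0) {a N : ℝ≥0∞}
    (h : ∀ N' : ℝ≥0∞, N < N' → N' ≠ ∞ → a ≤ K * N') : a ≤ K * N := by
  have hK' : (K : ℝ≥0∞) ≠ 0 := by simpa using hK
  rw [mul_comm, ← ENNReal.div_le_iff hK' (by simp)]
  refine le_of_forall_gt_imp_ge_of_dense fun N' hN' => ?_
  rcases eq_or_ne N' ∞ with rfl | hNt
  · exact le_top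
  · rw [ENNReal.div_le_iff hK' (by simp), mul_comm]
    exact h N' hN' hNt

end Sufficiency

/-! ### Testing on characteristic functions of balls. -/

section Necessity

variable {n : ℕ} {Φ : ℝ≥0∞ → ℝ≥0∞} {φ : ℝ → ℝ}

/-- The norm of the characteristic function of a ball. -/
theorem exists_morreyNorm_indicator_ball_le (n : ℕ) (𝕜 : Type*) [RCLike 𝕜] (h : IsYoung Φ)
    (hφ : ClassG n Φ φ) (hφd : AlmostDecreasing fun t => ENNReal.ofReal (φ t)) :
    ∃ c : ℝ≥0, ∀ t : ℝ, 0 < t →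
      morreyNorm Φ φ ((Metric.ball (0 : EuclideanSpace ℝ (Fin n)) t).indicator fun _ => (1 : 𝕜)) ≤
        c / ENNReal.ofReal (φ t) := by
  obtain ⟨c₀, hc₀1, hc₀⟩ := h.exists_youngInv_volume_le n
  obtain ⟨c₁, -, hc₁⟩ := hφ.almostIncreasing
  obtain ⟨c₂, -, hc₂⟩ := hφd
  have hc₀0 : (c₀ : ℝ≥0∞) ≠ 0 := by exact_mod_cast (one_pos.trans_le hc₀1).ne'
  have hle : ∀ (s : Set (EuclideanSpace ℝ (Fin n))) (x : EuclideanSpace ℝ (Fin n)) (r : ℝ), 0 < r →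
      s ⊆ Metric.ball x r → MeasurableSet s →
      orliczNorm Φ (s.indicator fun _ => (1 : 𝕜)) ≤ c₀ / invAt n Φ r := by
    intro s x r hr hs hsm
    have hi0 := (h.invAt_pos n hr).ne'
    have hit := (h.invAt_lt_top n r).ne
    refine orliczNorm_le Φ (ENNReal.div_pos hc₀0 hit).ne'
      (ENNReal.div_ne_top (by simp) hi0) ?_
    rw [h.lintegral_indicator_div _ hsm, setLIntegral_const, enorm_one, one_div,
      ENNReal.inv_div (Or.inl hit) (Or.inl hi0)]
    refine (mul_le_mul_right (measure_mono hs) _).trans ((h.mul_volume_le_one_iff x hr).2 ?_)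
    refine ENNReal.div_le_of_le_mul ?_
    rw [mul_comm]
    exact (hc₀ x r hr).2
  refine ⟨c₀ * max c₁ c₂, fun t ht => ?_⟩
  have hφt : ENNReal.ofReal (φ t) ≠ 0 := by simpa using hφ.pos t ht
  have hmax1 : (c₁ : ℝ≥0∞) ≤ max c₁ c₂ := by exact_mod_cast le_max_left c₁ c₂
  have hmax2 : (c₂ : ℝ≥0∞) ≤ max c₁ c₂ := by exact_mod_cast le_max_right c₁ c₂
  rw [morreyNorm_le_iff h hφ.pos]
  intro x r hr
  rw [indicator_indicator]
  have hms : MeasurableSet (Metric.ball x r ∩ Metric.ball (0 : EuclideanSpace ℝ (Fin n)) t) :=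
    measurableSet_ball.inter measurableSet_ball
  -- For `t ≤ r` the intersection is enlarged to `B(0,t)` and `morreyScale` almost increasing is
  -- used; for `r ≤ t` it is enlarged to `B(x,r)` and `φ` almost decreasing is used.
  rcases le_total t r with htr | hrt
  · refine (hle _ 0 t ht inter_subset_right hms).trans ?_
    have h1 : morreyScale n Φ φ t ≤ c₁ * morreyScale n Φ φ r := hc₁ t r ht htr
    have h2 : (invAt n Φ t)⁻¹ = morreyScale n Φ φ t / ENNReal.ofReal (φ t) := by
      rw [morreyScale, div_eq_mul_inv, div_eq_mul_inv, mul_right_comm,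
        ENNReal.mul_inv_cancel hφt ENNReal.ofReal_ne_top, one_mul]
    calc c₀ / invAt n Φ t = c₀ * (morreyScale n Φ φ t / ENNReal.ofReal (φ t)) := by
          rw [← h2, div_eq_mul_inv]
      _ ≤ c₀ * (max c₁ c₂ * morreyScale n Φ φ r / ENNReal.ofReal (φ t)) := by
          gcongr; exact h1.trans (by gcongr)
      _ = _ := by push_cast; simp only [div_eq_mul_inv]; ring
  · refine (hle _ x r hr inter_subset_left hms).trans ?_
    have h1 : ENNReal.ofReal (φ t) ≤ c₂ * ENNReal.ofReal (φ r) := hc₂ r t hr hrt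
    calc c₀ / invAt n Φ r = c₀ / invAt n Φ r * (ENNReal.ofReal (φ t) / ENNReal.ofReal (φ t)) := by
          rw [ENNReal.div_self hφt ENNReal.ofReal_ne_top, mul_one]
      _ ≤ c₀ / invAt n Φ r * (max c₁ c₂ * ENNReal.ofReal (φ r) / ENNReal.ofReal (φ t)) := by
          gcongr; exact h1.trans (by gcongr)
      _ = _ := by rw [morreyScale]; push_cast; simp only [div_eq_mul_inv]; ring

/-- A lower bound for the weak norm of a function that is large on a ball. -/
theorem exists_le_mul_weakMorreyNorm (n : ℕ) (h : IsYoung Φ) (φ : ℝ → ℝ) :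
    ∃ c : ℝ≥0, ∀ (g : EuclideanSpace ℝ (Fin n) → ℝ≥0∞) (t : ℝ), 0 < t → 0 < φ t → ∀ l : ℝ≥0,
      (∀ x ∈ Metric.ball (0 : EuclideanSpace ℝ (Fin n)) t, (l : ℝ≥0∞) < g x) →
        (l : ℝ≥0∞) ≤ c * ENNReal.ofReal (φ t) * weakMorreyNorm Φ φ g := by
  obtain ⟨c, -, hc⟩ := h.exists_youngInv_volume_le n
  refine ⟨c, fun g t ht hφt l hl => ?_⟩
  rcases eq_or_ne l 0 with rfl | hl0
  · simp
  set B := Metric.ball (0 : EuclideanSpace ℝ (Fin n)) t with hB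
  have hi0 := (h.invAt_pos n ht).ne'
  have hit := (h.invAt_lt_top n t).ne
  have h1 : (l : ℝ≥0∞) / (c * invAt n Φ t) ≤
      orliczNorm Φ (B.indicator fun _ => (l : ℝ≥0∞)) := by
    refine le_sInf fun L ⟨hL0, hLt, hL⟩ => ?_
    rw [h.lintegral_indicator_div _ measurableSet_ball, setLIntegral_const, enorm_eq_self,
      h.mul_volume_le_one_iff 0 ht] at hL
    have h2 := hL.trans (hc 0 t ht).1
    refine ENNReal.div_le_of_le_mul ?_
    rwa [ENNReal.div_le_iff hL0.ne' hLt.ne, mul_comm] at h2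
  have h2 : orliczNorm Φ (B.indicator fun _ => (l : ℝ≥0∞)) ≤ weakOrliczNorm Φ (B.indicator g) := by
    refine le_trans (h.orliczNorm_mono fun x => ?_)
      (le_iSup₂_of_le l (pos_iff_ne_zero.2 hl0) le_rfl)
    by_cases hx : x ∈ B
    · rw [indicator_of_mem hx, indicator_of_mem]
      simpa [hx] using hl x hx
    · simp [hx]
  have h3 : (ENNReal.ofReal (φ t))⁻¹ * invAt n Φ t * weakOrliczNorm Φ (B.indicator g) ≤
      weakMorreyNorm Φ φ g :=
    le_iSup_of_le 0 (le_iSup₂_of_le t ht le_rfl)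
  have hφ0 : ENNReal.ofReal (φ t) ≠ 0 := by simpa using hφt
  rcases eq_or_ne c 0 with rfl | hc0
  · have h4 := (hc 0 t ht).2
    simp [hi0] at h4
  have hc0' : (c : ℝ≥0∞) ≠ 0 := by simpa using hc0
  calc (l : ℝ≥0∞) = l / (c * invAt n Φ t) * (c * invAt n Φ t) := by
        rw [ENNReal.div_mul_cancel (mul_ne_zero hc0' hi0) (ENNReal.mul_ne_top (by simp) hit)]
    _ ≤ weakOrliczNorm Φ (B.indicator g) * (c * invAt n Φ t) := by
        gcongr; exact h1.trans h2
    _ = c * (ENNReal.ofReal (φ t) * (ENNReal.ofReal (φ t))⁻¹) * (invAt n Φ t *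
          weakOrliczNorm Φ (B.indicator g)) := by
        rw [ENNReal.mul_inv_cancel hφ0 ENNReal.ofReal_ne_top]; ring
    _ = c * ENNReal.ofReal (φ t) * ((ENNReal.ofReal (φ t))⁻¹ * invAt n Φ t *
          weakOrliczNorm Φ (B.indicator g)) := by ring
    _ ≤ _ := by gcongr

/-- The ball `B(x,2t)` contains `B(0,t)`, so the average is `2^(-n)`, and `ρ(2t) ≥ ρ(t)`. The extra
factor `2` makes the inequality strict, as the sets `{|f| > l}` in the weak norm demand. -/
theorem lt_fracMax_indicator_ball (𝕜 : Type*) [RCLike 𝕜] {ρ : ℝ → ℝ}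
    (hρ_pos : ∀ r, 0 < r → 0 < ρ r) (hρ_mono : MonotoneOn ρ (Ioi 0)) {t : ℝ} (ht : 0 < t)
    {x : EuclideanSpace ℝ (Fin n)} (hx : x ∈ Metric.ball (0 : EuclideanSpace ℝ (Fin n)) t) :
    ENNReal.ofReal (ρ t / 2 ^ (n + 1)) < fracMax ρ
      ((Metric.ball (0 : EuclideanSpace ℝ (Fin n)) t).indicator fun _ => (1 : 𝕜)) x := by
  have hsub : Metric.ball (0 : EuclideanSpace ℝ (Fin n)) t ⊆ Metric.ball x (2 * t) := by
    refine Metric.ball_subset_ball' ?_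
    rw [Metric.mem_ball, dist_comm] at hx
    linarith
  set V := volume (Metric.ball (0 : EuclideanSpace ℝ (Fin n)) t) with hV
  have hV0 : V ≠ 0 := volume_ball_ne_zero _ ht
  have hVt : V ≠ ∞ := volume_ball_ne_top _ _
  have hint : ∫⁻ y in Metric.ball x (2 * t),
      ‖(Metric.ball (0 : EuclideanSpace ℝ (Fin n)) t).indicator (fun _ => (1 : 𝕜)) y‖ₑ = V := by
    simp only [enorm_indicator_eq_indicator_enorm, enorm_one]
    rw [lintegral_indicator_const measurableSet_ball, one_mul,
      Measure.restrict_apply measurableSet_ball, inter_eq_left.2 hsub]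
  have hvol : volume (Metric.ball x (2 * t)) = ENNReal.ofReal (2 ^ n) * V := by
    rw [hV, volume_ball_eq x (by positivity), volume_ball_eq 0 ht, mul_pow,
      ENNReal.ofReal_mul (by positivity), mul_assoc]
  have hρt := hρ_pos t ht
  have h2t : ρ t ≤ ρ (2 * t) := hρ_mono ht (by simpa using ht) (by linarith)
  calc ENNReal.ofReal (ρ t / 2 ^ (n + 1)) < ENNReal.ofReal (ρ (2 * t) / 2 ^ n) := by
        rw [ENNReal.ofReal_lt_ofReal_iff_of_nonneg (by positivity)]
        calc ρ t / 2 ^ (n + 1) < ρ t / 2 ^ n := by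
              gcongr <;> norm_num
          _ ≤ _ := by gcongr
    _ = ENNReal.ofReal (ρ (2 * t)) / volume (Metric.ball x (2 * t)) * V := by
        rw [hvol, ENNReal.ofReal_div_of_pos (by positivity), div_eq_mul_inv, div_eq_mul_inv,
          ENNReal.mul_inv (Or.inr hVt) (Or.inr hV0), mul_assoc, mul_assoc,
          ENNReal.inv_mul_cancel hV0 hVt, mul_one]
    _ ≤ _ := by
        rw [← hint]
        exact le_iSup₂_of_le (2 * t) (by positivity) le_rfl

theorem exists_le_mul_rpow_of_weakMorreyNorm_le (n : ℕ) (𝕜 : Type*) [RCLike 𝕜]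
    {Ψ : ℝ≥0∞ → ℝ≥0∞} {η ρ : ℝ → ℝ} {β : ℝ} (h : IsYoung Φ) (hφ : ClassG n Φ φ)
    (hφd : AlmostDecreasing fun t => ENNReal.ofReal (φ t)) (hβ0 : 0 < β) (hβ1 : β < 1)
    (hη : ∀ t, 0 < t → η t = φ t ^ β) (hΨ : ∀ t, Ψ t = Φ (t ^ (1 / β)))
    (hρ_pos : ∀ r, 0 < r → 0 < ρ r) (hρ_mono : MonotoneOn ρ (Ioi 0)) {C : ℝ≥0}
    (hC : ∀ f : EuclideanSpace ℝ (Fin n) → 𝕜, MemMorrey Φ φ f →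
      weakMorreyNorm Ψ η (fracMax ρ f) ≤ C * morreyNorm Φ φ f) :
    ∃ C : ℝ, 0 < C ∧ ∀ t, 0 < t → ρ t ≤ C * φ t ^ (β - 1) := by
  obtain ⟨c, hc⟩ := exists_morreyNorm_indicator_ball_le n 𝕜 h hφ hφd
  obtain ⟨c', hc'⟩ := exists_le_mul_weakMorreyNorm n (h.comp_rpow hβ0 hβ1.le hΨ) η
  -- The added `1` only ensures that the constant is positive.
  refine ⟨2 ^ (n + 1) * (c' * C * c) + 1, by positivity, fun t ht => ?_⟩
  have hφt := hφ.pos t ht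
  have hφt' : ENNReal.ofReal (φ t) ≠ 0 := by simpa using hφt
  have hηt : 0 < η t := by rw [hη t ht]; positivity
  set f := (Metric.ball (0 : EuclideanSpace ℝ (Fin n)) t).indicator fun _ => (1 : 𝕜) with hf
  have hfN := hc t ht
  have hfM : MemMorrey Φ φ f := by
    refine h.memMorrey hφ.pos ?_ (hfN.trans_lt (ENNReal.div_lt_top (by simp) hφt'))
    exact (stronglyMeasurable_const.indicator measurableSet_ball).aestronglyMeasurable
  have h1 := hc' (fracMax ρ f) t ht hηt (ρ t / 2 ^ (n + 1)).toNNReal fun x hx =>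
    lt_fracMax_indicator_ball 𝕜 hρ_pos hρ_mono ht hx
  have h2 : ENNReal.ofReal (ρ t / 2 ^ (n + 1)) ≤ ENNReal.ofReal (c' * η t * (C * (c / φ t))) := by
    calc ENNReal.ofReal (ρ t / 2 ^ (n + 1))
        ≤ c' * ENNReal.ofReal (η t) * weakMorreyNorm Ψ η (fracMax ρ f) := h1
      _ ≤ c' * ENNReal.ofReal (η t) * (C * (c / ENNReal.ofReal (φ t))) := by
          gcongr
          exact (hC f hfM).trans (by gcongr)
      _ = _ := by
          rw [ENNReal.ofReal_mul (by positivity), ENNReal.ofReal_mul (by positivity),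
            ENNReal.ofReal_mul (by positivity), ENNReal.ofReal_div_of_pos hφt]
          simp only [ENNReal.ofReal_coe_nnreal]
  rw [ENNReal.ofReal_le_ofReal_iff (by positivity), div_le_iff₀ (by positivity), hη t ht] at h2
  have h3 : φ t ^ β / φ t = φ t ^ (β - 1) := by rw [Real.rpow_sub hφt, Real.rpow_one]
  have h4 : 0 < φ t ^ (β - 1) := by positivity
  calc ρ t ≤ c' * φ t ^ β * (C * (c / φ t)) * 2 ^ (n + 1) := h2
    _ = 2 ^ (n + 1) * (c' * C * c) * (φ t ^ β / φ t) := by ring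
    _ ≤ _ := by rw [h3]; gcongr; linarith

end Necessity

end OrliczMorrey

theorem mainTheorem6 (n : ℕ) (hn : 0 < n) (𝕜 : Type*) [RCLike 𝕜]
    (Φ : ℝ≥0∞ → ℝ≥0∞) (hΦ : OrliczMorrey.IsYoung Φ)
    (φ : ℝ → ℝ) (hφ : OrliczMorrey.ClassG n Φ φ)
    (hφd : OrliczMorrey.AlmostDecreasing fun t => ENNReal.ofReal (φ t))
    (ρ : ℝ → ℝ) (hρ_pos : ∀ r, 0 < r → 0 < ρ r)
    (hρ_mono : MonotoneOn ρ (Set.Ioi 0))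
    (hρ_anti : AntitoneOn (fun r => ρ r / r ^ n) (Set.Ioi 0))
    (β : ℝ) (hβ0 : 0 < β) (hβ1 : β < 1)
    (η : ℝ → ℝ) (hη : ∀ t, 0 < t → η t = φ t ^ β)
    (Ψ : ℝ≥0∞ → ℝ≥0∞) (hΨ : ∀ t, Ψ t = Φ (t ^ (1 / β))) :
    ((∃ C : ℝ, 0 < C ∧ ∀ t, 0 < t → ρ t ≤ C * φ t ^ (β - 1)) ↔
      OrliczMorrey.FracMaxWeakBounded n 𝕜 ρ Φ φ Ψ η) ∧
    (OrliczMorrey.Nabla2 Φ →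
      ((∃ C : ℝ, 0 < C ∧ ∀ t, 0 < t → ρ t ≤ C * φ t ^ (β - 1)) ↔
        OrliczMorrey.FracMaxBounded n 𝕜 ρ Φ φ Ψ η)) := by
  have hΨY := hΦ.comp_rpow hβ0 hβ1.le hΨ
  have hη0 : ∀ t, 0 < t → 0 < η t := fun t ht => by
    rw [hη t ht]; exact Real.rpow_pos_of_pos (hφ.pos t ht) β
  refine ⟨⟨?_, ?_⟩, fun hN2 => ⟨?_, ?_⟩⟩
  · rintro ⟨C, hC, hρ⟩
    obtain ⟨K, hK0, hK⟩ := OrliczMorrey.exists_weakMorreyNorm_fracMax_le (n := n) (F := 𝕜)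
      hΦ hφ hφd hβ0 hβ1 hη hΨ hC hρ
    refine ⟨K, fun f hf => ?_⟩
    have hle : OrliczMorrey.weakMorreyNorm Ψ η (OrliczMorrey.fracMax ρ f) ≤
        K * OrliczMorrey.morreyNorm Φ φ f := by
      refine OrliczMorrey.le_mul_of_forall_gt hK0 fun N hN hNt => ?_
      exact hK N ((zero_le).trans_lt hN).ne' hNt f hf.measurable.enorm
        (OrliczMorrey.morreyModular_of_morreyNorm_lt hΦ hφ.pos hN)
    exact ⟨hΨY.memWeakMorrey hη0 (OrliczMorrey.measurable_fracMax ρ f).aestronglyMeasurable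
      (hle.trans_lt (ENNReal.mul_lt_top (by simp) hf.norm_lt_top)), hle⟩
  · rintro ⟨C, hC⟩
    exact OrliczMorrey.exists_le_mul_rpow_of_weakMorreyNorm_le n 𝕜 hΦ hφ hφd hβ0 hβ1 hη hΨ
      hρ_pos hρ_mono fun f hf => (hC f hf).2
  · rintro ⟨C, hC, hρ⟩
    obtain ⟨K, hK0, hK⟩ := OrliczMorrey.exists_morreyNorm_fracMax_le (n := n) (F := 𝕜)
      hΦ hN2 hφ hφd hβ0 hβ1 hη hΨ hC hρ
    refine ⟨K, fun f hf => ?_⟩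
    have hle : OrliczMorrey.morreyNorm Ψ η (OrliczMorrey.fracMax ρ f) ≤
        K * OrliczMorrey.morreyNorm Φ φ f := by
      refine OrliczMorrey.le_mul_of_forall_gt hK0 fun N hN hNt => ?_
      exact hK N ((zero_le).trans_lt hN).ne' hNt f hf.measurable.enorm
        (OrliczMorrey.morreyModular_of_morreyNorm_lt hΦ hφ.pos hN)
    exact ⟨hΨY.memMorrey hη0 (OrliczMorrey.measurable_fracMax ρ f).aestronglyMeasurable
      (hle.trans_lt (ENNReal.mul_lt_top (by simp) hf.norm_lt_top)), hle⟩
  -- The strong norm dominates the weak one, so the weak necessity argument applies.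
  · rintro ⟨C, hC⟩
    exact OrliczMorrey.exists_le_mul_rpow_of_weakMorreyNorm_le n 𝕜 hΦ hφ hφd hβ0 hβ1 hη hΨ
      hρ_pos hρ_mono fun f hf =>
        (OrliczMorrey.weakMorreyNorm_le_morreyNorm hΨY _).trans (hC f hf).2
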